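/- Let $T>0$, $\beta\in(0,1)$, $x^0<0$, and let $C_0>0$ be such that $\psi(t,x)=|x-x^0|^2-\beta t^2+C_0$ satisfies $\psi\ge 1$ on $[-T,T]\times[0,1]$. For $\lambda>0$ put $\varphi(t,x)=e^{\lambda\psi(t,x)}$. For $N\in\mathbb N$ let $h=1/(N+1)$ and $x_j=jh$ for $0\le j\le N+1$. For discrete functions write $\int_{(0,1)}f_h=h\sum_{j=1}^N f_{j,h}$, $\int_{[0,1)}f_h=h\sum_{j=0}^N f_{j,h}$, $(\partial_h^+v_h)_j=(\partial_h^-v_h)_{j+1}=\frac{v_{j+1,h}-v_{j,h}}{h}$, $(\Delta_hv_h)_j=\frac{v_{j+1,h}-2v_{j,h}+v_{j-1,h}}{h^2}$, and let $L_hw_h=\partial_{tt}w_h-\Delta_hw_h$ for real-valued semi-discrete functions $w_h=(w_{j,h}(t))_{0\le j\le N+1}$, $t\in[-T,T]$. In the discrete integrals below, $\varphi$ is evaluated at $(t,x_j)$. Then there exist $s_0>0$, $\lambda>0$, $\varepsilon>0$, $h_0>0$ and $M>0$, depending only on $T,\beta,x^0,C_0$ (in particular independent of $h$, $s$ and $w_h$),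 such that for all $h=1/(N+1)\in(0,h_0)$, all $s\in(s_0,\varepsilon/h)$ and all $w_h$ with $w_{j,h}\in H^2(-T,T)$ for $1\le j\le N$ (that is, $L_hw_h\in L^2(-T,T;L^2_h(0,1))$, i.e. $(L_hw_h)_j\in L^2(-T,T)$ for $1\le j\le N$), $w_{0,h}(t)=w_{N+1,h}(t)=0$ on $(-T,T)$ and $w_h(\pm T)=\partial_tw_h(\pm T)=0$, one has $$ \begin{aligned} & s\int_{-T}^{T}\int_{(0,1)}e^{2s\varphi}|\partial_tw_h|^2\,dt +s\int_{-T}^{T}\int_{[0,1)}e^{2s\varphi}|\partial_h^+w_h|^2\,dt +s^3\int_{-T}^{T}\int_{(0,1)}e^{2s\varphi}|w_h|^2\,dt\\ &\quad\le M\int_{-T}^{T}\int_{(0,1)}e^{2s\varphi}|L_hw_h|^2\,dt +Ms\int_{-T}^{T}e^{2s\varphi(t,1)}\left|(\partial_h^-w_h)_{N+1}\right|^2dt\\ &\qquad+Ms\int_{-T}^{T}\int_{[0,1)}e^{2s\varphi}\left|h\,\partial_h^+\partial_tw_h\right|^2dt . \end{aligned} $$ -/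

import Mathlib

open Set MeasureTheory

namespace DiscreteWave

noncomputable section

/-- The mesh size `h = 1/(N+1)` of the uniform grid `0 = x₀ < x₁ < ⋯ < x_{N+1} = 1`. -/
def mesh (N : ℕ) : ℝ := 1 / ((N : ℝ) + 1)

/-- The grid point `x_j = j h`. -/
def node (N j : ℕ) : ℝ := (j : ℝ) * mesh N

/-- `ψ(t,x) = |x - x⁰|² - β t² + C₀`. -/
def psi (x0 β C0 t x : ℝ) : ℝ := |x - x0| ^ 2 - β * t ^ 2 + C0

/-- `φ(t,x) = exp(λ ψ(t,x))`. -/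
def phi (x0 β C0 lam t x : ℝ) : ℝ := Real.exp (lam * psi x0 β C0 t x)

/-- The discrete integral over `(0,1)`: `h ∑_{j=1}^{N} f_j`. -/
def intOpen (N : ℕ) (f : ℕ → ℝ) : ℝ := mesh N * ∑ j ∈ Finset.Icc 1 N, f j

/-- The discrete integral over `[0,1)`: `h ∑_{j=0}^{N} f_j`. -/
def intLeft (N : ℕ) (f : ℕ → ℝ) : ℝ := mesh N * ∑ j ∈ Finset.range (N + 1), f j

/-- `(∂_h^+ u)_j = (u_{j+1} - u_j)/h`, for `0 ≤ j ≤ N`. -/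
def dPlus (N : ℕ) (u : ℕ → ℝ) (j : ℕ) : ℝ := (u (j + 1) - u j) / mesh N

/-- `(∂_h^- u)_j = (u_j - u_{j-1})/h`; only meant (and used) for `1 ≤ j ≤ N+1`. -/
def dMinus (N : ℕ) (u : ℕ → ℝ) (j : ℕ) : ℝ := (u j - u (j - 1)) / mesh N

/-- `(Δ_h u)_j = (u_{j+1} - 2 u_j + u_{j-1})/h²`; only meant (and used) for `1 ≤ j ≤ N`. -/
def lap (N : ℕ) (u : ℕ → ℝ) (j : ℕ) : ℝ := (u (j + 1) - 2 * u j + u (j - 1)) / mesh N ^ 2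

/-- The time derivative on `[-T,T]` (one-sided at `±T`) of a semi-discrete function
`w`, where `w j t` is the value at the grid point `x_j` and the time `t`. -/
def dt (T : ℝ) (w : ℕ → ℝ → ℝ) (j : ℕ) (t : ℝ) : ℝ := derivWithin (w j) (Icc (-T) T) t

/-- The semi-discrete wave operator `(L_h w)_j(t) = ∂_tt w_j(t) - (Δ_h w(t))_j`. -/
def waveOp (T : ℝ) (N : ℕ) (w : ℕ → ℝ → ℝ) (j : ℕ) (t : ℝ) : ℝ :=
  dt T (dt T w) j t - lap N (fun i => w i t) j

/-- The admissible functions of the estimate. That `L_h w` makes sense and lies in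
`L²(-T,T; L²_h(0,1))` means that each `w_j`, `1 ≤ j ≤ N`, is in `H²(-T,T)`: `w_j` is
differentiable on `[-T,T]`, `∂_t w_j` is absolutely continuous there (so that `∂_tt w_j` exists
almost everywhere and is the weak second derivative), and `(L_h w)_j` is square integrable. -/
structure Admissible (T : ℝ) (N : ℕ) (w : ℕ → ℝ → ℝ) : Prop where
  differentiable : ∀ j ∈ Finset.Icc 1 N, DifferentiableOn ℝ (w j) (Icc (-T) T)
  absolutelyContinuous :
    ∀ j ∈ Finset.Icc 1 N, AbsolutelyContinuousOnInterval (dt T w j) (-T) T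
  memL2 : ∀ j ∈ Finset.Icc 1 N, MemLp (waveOp T N w j) 2 (volume.restrict (Ioo (-T) T))
  boundary : ∀ t ∈ Ioo (-T) T, w 0 t = 0 ∧ w (N + 1) t = 0
  final : ∀ j ∈ Finset.Icc 1 N, w j T = 0 ∧ dt T w j T = 0
  initial : ∀ j ∈ Finset.Icc 1 N, w j (-T) = 0 ∧ dt T w j (-T) = 0

end

end DiscreteWave

/-! The proof follows the continuous Carleman argument, with every coefficient controlled uniformly
in the mesh. Put `v = e^{sφ} w`, `u = ∂_t v` and `τ = sh`. Up to a remainder of size `s|v|`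
(`exists_remainder_bound`), the conjugated operator is `A + sB`. Here `A` has second order with
coefficients `c` and `Q`, and `B` is the first order multiplier with coefficient `m` and zeroth
order part `-θ v`. Since `4sAB ≤ (A + sB)²`, a lower bound for the sum of `AB` suffices.

Summation by parts (`sum_mul_eq_edgeDensity`) writes this sum as the time derivative of an energy,
plus a quadratic density on the edges, plus boundary terms. The term at `x = 0` has the good sign
because `φ_x ≥ 0` there; the term at `x = 1` is the observation. The coefficients depend
continuously on `(τ, t, x)` up to `τ = 0`, where they are those of the continuous problem. Hence for
small `h` and `τ` and large `s`, pseudoconvexity makes the density coercive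
(`exists_edge_lower_bound`), except for a defect `-C (u_{j+1} - u_j)²` of the discrete product rule.
This defect is not small at high frequency; it produces the term with `h ∂_h^+ ∂_t w`
(`exists_increment_bound`).

The remaining errors are absorbed for `s` large and `τ` small (`exists_pointwise_estimate`). The
energy derivative integrates to zero because the Cauchy data vanish at `±T` (`integral_energyRate`).
For `φ = e^{λψ}`, the choice `θ = λ²(ψ_t² - ψ_x²)φ` gives both positivity conditions with one
explicit `λ` (`expWeight`). -/

namespace DiscreteWave

noncomputable section

/-! ### Summation by parts on the grid, and coercivity under perturbation -/

/-- A sum over interior nodes whose summand splits into contributions of the two adjacent edges is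
a sum over edges, up to the two outer contributions. -/
lemma sum_nodes_eq_sum_edges {N : ℕ} {X l r : ℕ → ℝ} (hX : ∀ j, X (j + 1) = l (j + 1) + r j) :
    ∑ j ∈ Finset.Icc 1 N, X j = ∑ j ∈ Finset.range (N + 1), (l j + r j) - l 0 - r N := by
  induction N with
  | zero => simp
  | succ n ih => rw [Finset.sum_Icc_succ_top (by omega), ih, Finset.sum_range_succ _ (n + 1), hX]; ring

lemma sum_nodes_eq_sum_edges_avg {N : ℕ} {X : ℕ → ℝ} (h0 : X 0 = 0) (h1 : X (N + 1) = 0) :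
    ∑ j ∈ Finset.Icc 1 N, X j = ∑ j ∈ Finset.range (N + 1), (X j + X (j + 1)) / 2 := by
  rw [sum_nodes_eq_sum_edges (l := fun j => X j / 2) (r := fun j => X (j + 1) / 2)
    (fun j => by ring)]
  simp only [h0, h1, zero_div, sub_zero]
  exact Finset.sum_congr rfl fun j _ => by ring

/-- The edge density left over in the product of the two conjugated parts of the wave operator after
summation by parts; `k` is the inverse of the mesh size, primes denote the right end point. -/
def edgeDensity (k s pt pt' m m' mt mt' th th' tht tht' c c' Q Q' p p' gt gt' qpt qpt' u u' v v' : ℝ) :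
    ℝ :=
  ((pt + th + (m' - m) * k) * u ^ 2 + (gt + (c' * m' - c * m) * k - c * th) * ((v' - v) * k) ^ 2
      - 2 * (mt + (c' * p' - c * p) * k) * u * ((v' - v) * k)
      + s ^ 2 * (qpt - Q * th - (Q' * m' - Q * m) * k) * v ^ 2
      + tht * v * u - (c' * th' - c * th) * k * v * ((v' - v) * k)) / 2
  + ((pt' + th' + (m' - m) * k) * u' ^ 2
      + (gt' + (c' * m' - c * m) * k - c' * th') * ((v' - v) * k) ^ 2
      - 2 * (mt' + (c' * p' - c * p) * k) * u' * ((v' - v) * k)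
      + s ^ 2 * (qpt' - Q' * th' - (Q' * m' - Q * m) * k) * v' ^ 2
      + tht' * v' * u' - (c' * th' - c * th) * k * v' * ((v' - v) * k)) / 2
  - (m' - m) * k * (u' - u) ^ 2 / 2 + s ^ 2 * ((Q' * m' - Q * m) * k) * (v' - v) ^ 2 / 2

/-- Pure algebra: `pt`, `mt`, `tht`, `gt`, `qpt` and `z` are free sequences. They are later the time
derivatives of `p`, `m`, `th`, `c p`, `Q p` and `u`, which turns the first bracket into the
derivative of an energy. The Dirichlet values reduce the outer contributions to two squares. -/
theorem sum_mul_eq_edgeDensity (N : ℕ) (k s : ℝ) (p pt m mt th tht c Q gt qpt u v z : ℕ → ℝ)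
    (hv0 : v 0 = 0) (hv1 : v (N + 1) = 0) (hu0 : u 0 = 0) (hu1 : u (N + 1) = 0) :
    ∑ j ∈ Finset.Icc 1 N,
        (z j - c j * ((v (j + 1) - 2 * v j + v (j - 1)) * k ^ 2) + s ^ 2 * Q j * v j) *
          (-2 * p j * u j + 2 * m j * ((v (j + 1) - v (j - 1)) * k / 2) - th j * v j) =
      (∑ j ∈ Finset.Icc 1 N,
          (-pt j * u j ^ 2 - 2 * p j * u j * z j
            + 2 * mt j * u j * ((v (j + 1) - v (j - 1)) * k / 2)
            + 2 * m j * z j * ((v (j + 1) - v (j - 1)) * k / 2)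
            + 2 * m j * u j * ((u (j + 1) - u (j - 1)) * k / 2)
            - tht j * v j * u j - th j * u j ^ 2 - th j * v j * z j
            - s ^ 2 * qpt j * v j ^ 2 - 2 * s ^ 2 * (Q j * p j) * v j * u j)
        - ∑ j ∈ Finset.range (N + 1),
            ((gt j + gt (j + 1)) / 2 * ((v (j + 1) - v j) * k) ^ 2
              + (c j * p j + c (j + 1) * p (j + 1)) * ((v (j + 1) - v j) * k)
                * ((u (j + 1) - u j) * k)))
      + ∑ j ∈ Finset.range (N + 1),
          edgeDensity k s (pt j) (pt (j + 1)) (m j) (m (j + 1)) (mt j) (mt (j + 1)) (th j)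
            (th (j + 1)) (tht j) (tht (j + 1)) (c j) (c (j + 1)) (Q j) (Q (j + 1)) (p j) (p (j + 1))
            (gt j) (gt (j + 1)) (qpt j) (qpt (j + 1)) (u j) (u (j + 1)) (v j) (v (j + 1))
      + (c 0 * m 0 * (v 1 * k) ^ 2 - c (N + 1) * m (N + 1) * (v N * k) ^ 2) * k := by
  have key := sum_nodes_eq_sum_edges (N := N)
    (X := fun j => (z j - c j * ((v (j + 1) - 2 * v j + v (j - 1)) * k ^ 2) + s ^ 2 * Q j * v j) *
          (-2 * p j * u j + 2 * m j * ((v (j + 1) - v (j - 1)) * k / 2) - th j * v j) -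
          (-pt j * u j ^ 2 - 2 * p j * u j * z j
            + 2 * mt j * u j * ((v (j + 1) - v (j - 1)) * k / 2)
            + 2 * m j * z j * ((v (j + 1) - v (j - 1)) * k / 2)
            + 2 * m j * u j * ((u (j + 1) - u (j - 1)) * k / 2)
            - tht j * v j * u j - th j * u j ^ 2 - th j * v j * z j
            - s ^ 2 * qpt j * v j ^ 2 - 2 * s ^ 2 * (Q j * p j) * v j * u j))
    -- Terms living at a node are halved between its two edges; products of neighbouring values go
    -- to the edge joining them. The product of second and centered differences is a difference of
    -- squares, so it separates too.
    (l := fun j => (pt j * u j ^ 2 + th j * u j ^ 2 + tht j * v j * u j + s ^ 2 * qpt j * v j ^ 2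
        - s ^ 2 * Q j * th j * v j ^ 2) / 2
        - mt j * u j * ((v (j + 1) - v j) * k) - m j * u j * (u (j + 1) * k)
        + 2 * c j * p j * u j * ((v (j + 1) - v j) * k ^ 2)
        - c j * m j * ((v (j + 1) - v j) * k) ^ 2 * k
        + c j * th j * v j * ((v (j + 1) - v j) * k ^ 2)
        + s ^ 2 * Q j * m j * v j * (v (j + 1) * k))
    (r := fun j => (pt (j + 1) * u (j + 1) ^ 2 + th (j + 1) * u (j + 1) ^ 2
        + tht (j + 1) * v (j + 1) * u (j + 1) + s ^ 2 * qpt (j + 1) * v (j + 1) ^ 2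
        - s ^ 2 * Q (j + 1) * th (j + 1) * v (j + 1) ^ 2) / 2
        - mt (j + 1) * u (j + 1) * ((v (j + 1) - v j) * k)
        + m (j + 1) * u (j + 1) * (u j * k)
        - 2 * c (j + 1) * p (j + 1) * u (j + 1) * ((v (j + 1) - v j) * k ^ 2)
        + c (j + 1) * m (j + 1) * ((v (j + 1) - v j) * k) ^ 2 * k
        - c (j + 1) * th (j + 1) * v (j + 1) * ((v (j + 1) - v j) * k ^ 2)
        - s ^ 2 * Q (j + 1) * m (j + 1) * v (j + 1) * (v j * k))
    (fun j => by simp only [Nat.add_sub_cancel]; ring)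
  rw [Finset.sum_sub_distrib, Finset.sum_congr (s₁ := Finset.range (N + 1)) (g := fun j =>
      edgeDensity k s (pt j) (pt (j + 1)) (m j) (m (j + 1)) (mt j) (mt (j + 1)) (th j)
            (th (j + 1)) (tht j) (tht (j + 1)) (c j) (c (j + 1)) (Q j) (Q (j + 1)) (p j) (p (j + 1))
            (gt j) (gt (j + 1)) (qpt j) (qpt (j + 1)) (u j) (u (j + 1)) (v j) (v (j + 1))
      - ((gt j + gt (j + 1)) / 2 * ((v (j + 1) - v j) * k) ^ 2
              + (c j * p j + c (j + 1) * p (j + 1)) * ((v (j + 1) - v j) * k)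
                * ((u (j + 1) - u j) * k))) rfl (fun j _ => by unfold edgeDensity; ring),
    Finset.sum_sub_distrib (s := Finset.range (N + 1))] at key
  simp only [hv0, hv1, hu0, hu1, zero_add] at key
  linear_combination key

/-- Lower-case coefficients are the limits, upper-case ones the actual values. The couplings `F` and
`D` may be as large as `η s`, since `v u = s⁻¹ (s v) u` and the norm contains `s v`. By Young's
inequality each of the three squares loses at most `3 η`. -/
lemma half_edge_lower_bound {κ η s a b e γ A B E G F D u v d : ℝ} (hs : 0 < s)
    (h1 : κ * (u ^ 2 + d ^ 2) ≤ a * u ^ 2 + b * d ^ 2 - 2 * e * u * d) (h2 : κ ≤ γ)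
    (hA : |A - a| ≤ η) (hB : |B - b| ≤ η) (hE : |E - e| ≤ η) (hG : |G - γ| ≤ η)
    (hF : |F| ≤ η * s) (hD : |D| ≤ η * s) :
    (κ - 3 * η) * (u ^ 2 + d ^ 2 + s ^ 2 * v ^ 2) ≤
      A * u ^ 2 + B * d ^ 2 - 2 * E * u * d + s ^ 2 * G * v ^ 2 + F * v * u - D * v * d := by
  have key : ∀ {K M : ℝ} (y z : ℝ), |K| ≤ M → |K * y * z| ≤ M * ((y ^ 2 + z ^ 2) / 2) := by
    intro K M y z hK
    have hM : 0 ≤ M := (abs_nonneg _).trans hK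
    rw [mul_assoc, abs_mul]
    refine mul_le_mul hK ?_ (abs_nonneg _) hM
    rw [abs_le]
    constructor <;> nlinarith [sq_nonneg (y + z), sq_nonneg (y - z)]
  have hη : 0 ≤ η := (abs_nonneg _).trans hA
  have h3 : (a - A) * u ^ 2 ≤ η * u ^ 2 :=
    mul_le_mul_of_nonneg_right (by linarith [(abs_le.1 hA).1]) (sq_nonneg u)
  have h4 : (b - B) * d ^ 2 ≤ η * d ^ 2 :=
    mul_le_mul_of_nonneg_right (by linarith [(abs_le.1 hB).1]) (sq_nonneg d)
  have h5 := (abs_le.1 (key u d hE)).2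
  have h6 : (κ - η) * (s ^ 2 * v ^ 2) ≤ G * (s ^ 2 * v ^ 2) :=
    mul_le_mul_of_nonneg_right (by linarith [(abs_le.1 hG).1]) (by positivity)
  have hF' : |F / s| ≤ η := by rw [abs_div, abs_of_pos hs, div_le_iff₀ hs]; exact hF
  have hD' : |D / s| ≤ η := by rw [abs_div, abs_of_pos hs, div_le_iff₀ hs]; exact hD
  have h7 := (abs_le.1 (key (s * v) u hF')).1
  have h8 := (abs_le.1 (key (s * v) d hD')).2
  have e7 : F / s * (s * v) * u = F * v * u := by field_simp
  have e8 : D / s * (s * v) * d = D * v * d := by field_simp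
  rw [e7] at h7
  rw [e8] at h8
  have := mul_nonneg hη (sq_nonneg u)
  have := mul_nonneg hη (sq_nonneg d)
  have := mul_nonneg hη (sq_nonneg (s * v))
  nlinarith

/-! ### Uniform control of coefficients as `τ` and `h` tend to zero -/

/-- The function `sinh y / y`, continuously extended to `0`. -/
def sinhc : ℝ → ℝ := dslope Real.sinh 0

lemma mul_sinhc (y : ℝ) : y * sinhc y = Real.sinh y := by
  simpa [sinhc] using sub_smul_dslope Real.sinh 0 y

@[simp] lemma sinhc_zero : sinhc 0 = 1 := by simp [sinhc, dslope_same]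

@[fun_prop] lemma continuous_sinhc : Continuous sinhc := by
  have := (continuousOn_dslope (f := Real.sinh) (a := 0) (s := univ) Filter.univ_mem).2
    ⟨Real.continuous_sinh.continuousOn, Real.differentiable_sinh.differentiableAt⟩
  exact continuousOn_univ.1 this

lemma mul_sinhc_mul {τ : ℝ} (hτ : τ ≠ 0) (y : ℝ) : y * sinhc (τ * y) = Real.sinh (τ * y) / τ := by
  rw [← mul_sinhc]; field_simp

lemma sq_mul_sinhc_half {τ : ℝ} (hτ : τ ≠ 0) (y : ℝ) :
    (y * sinhc (τ * y / 2)) ^ 2 = 2 * (Real.cosh (τ * y) - 1) / τ ^ 2 := by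
  have h1 : τ * y / 2 * sinhc (τ * y / 2) = Real.sinh (τ * y / 2) := mul_sinhc _
  have h2 : Real.cosh (τ * y) = Real.cosh (τ * y / 2) ^ 2 + Real.sinh (τ * y / 2) ^ 2 := by
    rw [← Real.cosh_two_mul]; congr 1; ring
  rw [h2, Real.cosh_sq, ← h1]
  field_simp
  ring

lemma exists_bound_of_continuous (T : ℝ) {F : ℝ → ℝ → ℝ → ℝ}
    (hF : Continuous fun q : ℝ × ℝ × ℝ => F q.1 q.2.1 q.2.2) :
    ∃ C, 0 < C ∧ ∀ τ ∈ Icc (0 : ℝ) 1, ∀ t ∈ Icc (-T) T, ∀ x ∈ Icc (0 : ℝ) 1, |F τ t x| ≤ C := by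
  obtain ⟨C, hC⟩ := ((isCompact_Icc (a := (0 : ℝ)) (b := 1)).prod
    ((isCompact_Icc (a := -T) (b := T)).prod
      (isCompact_Icc (a := (0 : ℝ)) (b := 1)))).exists_bound_of_continuousOn hF.continuousOn
  refine ⟨max C 1, by positivity, fun τ hτ t ht x hx => ?_⟩
  exact (hC (τ, t, x) ⟨hτ, ht, hx⟩).trans (le_max_left _ _)

/-- Uniform continuity on a compact set that includes `τ = 0`. The form "eventually as `δ → 0+`"
lets finitely many smallness requirements be intersected. -/
lemma eventually_close_of_continuous (T : ℝ) {F : ℝ → ℝ → ℝ → ℝ}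
    (hF : Continuous fun q : ℝ × ℝ × ℝ => F q.1 q.2.1 q.2.2) {η : ℝ} (hη : 0 < η) :
    ∀ᶠ δ in nhdsWithin (0 : ℝ) (Ioi 0), ∀ τ ∈ Icc 0 δ, ∀ t ∈ Icc (-T) T,
      ∀ x ∈ Icc (0 : ℝ) 1, ∀ y ∈ Icc (0 : ℝ) 1, |x - y| ≤ δ → |F τ t x - F 0 t y| ≤ η := by
  have huc := ((isCompact_Icc (a := (0 : ℝ)) (b := 1)).prod
    ((isCompact_Icc (a := -T) (b := T)).prod
      (isCompact_Icc (a := (0 : ℝ)) (b := 1)))).uniformContinuousOn_of_continuous hF.continuousOn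
  obtain ⟨δ, hδ, h⟩ := Metric.uniformContinuousOn_iff.1 huc η hη
  have h1 : Ioo 0 (min δ 1) ∈ nhdsWithin (0 : ℝ) (Ioi 0) := Ioo_mem_nhdsGT (by positivity)
  filter_upwards [h1] with r hr τ hτ t ht x hx y hy hxy
  have hr1 : r < δ := hr.2.trans_le (min_le_left _ _)
  have hr2 : r < 1 := hr.2.trans_le (min_le_right _ _)
  refine (h (τ, t, x) ⟨⟨hτ.1, hτ.2.trans hr2.le⟩, ht, hx⟩ (0, t, y) ⟨⟨le_rfl, zero_le_one⟩, ht, hy⟩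
    ?_).le
  simp only [Prod.dist_eq, dist_self, Real.dist_eq, sub_zero]
  refine max_lt ?_ (max_lt hδ (hxy.trans_lt hr1))
  rw [abs_of_nonneg hτ.1]
  exact hτ.2.trans_lt hr1

lemma exists_slope_eq {f F : ℝ → ℝ} (hf : ∀ x, HasDerivAt f (F x) x) {x h : ℝ} (hh : 0 < h) :
    ∃ y ∈ Ioo x (x + h), (f (x + h) - f x) * h⁻¹ = F y := by
  obtain ⟨y, hy, e⟩ := exists_hasDerivAt_eq_slope f F (by linarith : x < x + h)
    (fun z _ => (hf z).continuousAt.continuousWithinAt) (fun z _ => hf z)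
  exact ⟨y, hy, by rw [e, add_sub_cancel_left, div_eq_mul_inv]⟩

/-- By the mean value theorem a difference quotient is the derivative at an intermediate point with
the same `τ`. The derivative is needed only for `τ > 0`, but its formula `F` must be continuous up
to `τ = 0`. -/
lemma eventually_slope_close (T : ℝ) {f F : ℝ → ℝ → ℝ → ℝ}
    (hF : Continuous fun q : ℝ × ℝ × ℝ => F q.1 q.2.1 q.2.2)
    (hf : ∀ τ, 0 < τ → ∀ t x, HasDerivAt (f τ t) (F τ t x) x) {η : ℝ} (hη : 0 < η) :
    ∀ᶠ δ in nhdsWithin (0 : ℝ) (Ioi 0), ∀ τ ∈ Ioc 0 δ, ∀ t ∈ Icc (-T) T, ∀ h ∈ Ioc 0 δ,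
      ∀ x, 0 ≤ x → x + h ≤ 1 → |(f τ t (x + h) - f τ t x) * h⁻¹ - F 0 t x| ≤ η ∧
        |(f τ t (x + h) - f τ t x) * h⁻¹ - F 0 t (x + h)| ≤ η := by
  filter_upwards [eventually_close_of_continuous T hF hη] with δ hδ τ hτ t ht h hh x hx0 hx1
  obtain ⟨y, hy, e⟩ := exists_slope_eq (hf τ hτ.1 t) hh.1 (x := x)
  have hh0 := hh.1
  have hy' : y ∈ Icc (0 : ℝ) 1 := ⟨by linarith [hy.1], by linarith [hy.2]⟩
  rw [e]
  constructor
  · refine hδ τ ⟨hτ.1.le, hτ.2⟩ t ht y hy' x ⟨hx0, by linarith⟩ ?_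
    rw [abs_le]; constructor <;> linarith [hy.1, hy.2, hh.2]
  · refine hδ τ ⟨hτ.1.le, hτ.2⟩ t ht y hy' (x + h) ⟨by linarith, hx1⟩ ?_
    rw [abs_le]; constructor <;> linarith [hy.1, hy.2, hh.2]

/-! ### Carleman weights and the coefficients of the conjugated operator -/

/-- A smooth weight function `φ(t,x)` on `[-T,T] × [0,1]` with its derivatives of order at most two,
increasing in `x`, and pseudoconvex for the wave operator with respect to the zeroth order
multiplier `θ`. -/
structure CarlemanWeight (T : ℝ) where
  (φ φt φx φtt φtx φxx θ θt θx : ℝ → ℝ → ℝ)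
  κ : ℝ
  cont_φ : Continuous fun q : ℝ × ℝ => φ q.1 q.2
  cont_φt : Continuous fun q : ℝ × ℝ => φt q.1 q.2
  cont_φx : Continuous fun q : ℝ × ℝ => φx q.1 q.2
  cont_φtt : Continuous fun q : ℝ × ℝ => φtt q.1 q.2
  cont_φtx : Continuous fun q : ℝ × ℝ => φtx q.1 q.2
  cont_φxx : Continuous fun q : ℝ × ℝ => φxx q.1 q.2
  cont_θ : Continuous fun q : ℝ × ℝ => θ q.1 q.2
  cont_θt : Continuous fun q : ℝ × ℝ => θt q.1 q.2
  cont_θx : Continuous fun q : ℝ × ℝ => θx q.1 q.2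
  deriv_φt : ∀ t x, HasDerivAt (fun r => φ r x) (φt t x) t
  deriv_φx : ∀ t x, HasDerivAt (fun y => φ t y) (φx t x) x
  deriv_φtt : ∀ t x, HasDerivAt (fun r => φt r x) (φtt t x) t
  deriv_φtx : ∀ t x, HasDerivAt (fun r => φx r x) (φtx t x) t
  deriv_φxt : ∀ t x, HasDerivAt (fun y => φt t y) (φtx t x) x
  deriv_φxx : ∀ t x, HasDerivAt (fun y => φx t y) (φxx t x) x
  deriv_θt : ∀ t x, HasDerivAt (fun r => θ r x) (θt t x) t
  deriv_θx : ∀ t x, HasDerivAt (fun y => θ t y) (θx t x) x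
  κ_pos : 0 < κ
  φx_nonneg : ∀ t ∈ Icc (-T) T, ∀ x ∈ Icc (0 : ℝ) 1, 0 ≤ φx t x
  pseudoconvex : ∀ t ∈ Icc (-T) T, ∀ x ∈ Icc (0 : ℝ) 1, ∀ a b : ℝ,
    κ * (a ^ 2 + b ^ 2) ≤ (φtt t x + θ t x + φxx t x) * a ^ 2
      + (φtt t x + φxx t x - θ t x) * b ^ 2 - 2 * (2 * φtx t x) * a * b
  pseudoconvex_zero : ∀ t ∈ Icc (-T) T, ∀ x ∈ Icc (0 : ℝ) 1,
    κ ≤ (2 * φt t x * φtt t x - 2 * φx t x * φtx t x) * φt t x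
      + (φt t x ^ 2 - φx t x ^ 2) * φtt t x - (φt t x ^ 2 - φx t x ^ 2) * θ t x
      - ((2 * φt t x * φtx t x - 2 * φx t x * φxx t x) * φx t x
        + (φt t x ^ 2 - φx t x ^ 2) * φxx t x)

namespace CarlemanWeight

variable {T : ℝ} (W : CarlemanWeight T)

section Continuity

variable {X : Type*} [TopologicalSpace X] {a b : X → ℝ}

@[fun_prop] lemma continuous_φ (ha : Continuous a) (hb : Continuous b) :
    Continuous fun q => W.φ (a q) (b q) := W.cont_φ.comp (ha.prodMk hb)
@[fun_prop] lemma continuous_φt (ha : Continuous a) (hb : Continuous b) :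
    Continuous fun q => W.φt (a q) (b q) := W.cont_φt.comp (ha.prodMk hb)
@[fun_prop] lemma continuous_φx (ha : Continuous a) (hb : Continuous b) :
    Continuous fun q => W.φx (a q) (b q) := W.cont_φx.comp (ha.prodMk hb)
@[fun_prop] lemma continuous_φtt (ha : Continuous a) (hb : Continuous b) :
    Continuous fun q => W.φtt (a q) (b q) := W.cont_φtt.comp (ha.prodMk hb)
@[fun_prop] lemma continuous_φtx (ha : Continuous a) (hb : Continuous b) :
    Continuous fun q => W.φtx (a q) (b q) := W.cont_φtx.comp (ha.prodMk hb)
@[fun_prop] lemma continuous_φxx (ha : Continuous a) (hb : Continuous b) :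
    Continuous fun q => W.φxx (a q) (b q) := W.cont_φxx.comp (ha.prodMk hb)
@[fun_prop] lemma continuous_θ (ha : Continuous a) (hb : Continuous b) :
    Continuous fun q => W.θ (a q) (b q) := W.cont_θ.comp (ha.prodMk hb)
@[fun_prop] lemma continuous_θt (ha : Continuous a) (hb : Continuous b) :
    Continuous fun q => W.θt (a q) (b q) := W.cont_θt.comp (ha.prodMk hb)
@[fun_prop] lemma continuous_θx (ha : Continuous a) (hb : Continuous b) :
    Continuous fun q => W.θx (a q) (b q) := W.cont_θx.comp (ha.prodMk hb)

end Continuity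

/-- The coefficient of the discrete Laplacian in the conjugated operator, where `τ = s h`. -/
def c (τ t x : ℝ) : ℝ := Real.cosh (τ * W.φx t x)

/-- The coefficient of the centered difference in the conjugated operator. -/
def m (τ t x : ℝ) : ℝ := W.φx t x * sinhc (τ * W.φx t x)

/-- The discrete counterpart of `φ_t² - φ_x²`. -/
def Q (τ t x : ℝ) : ℝ := W.φt t x ^ 2 - (W.φx t x * sinhc (τ * W.φx t x / 2)) ^ 2

/-- The time derivative of `c`. -/
def ct (τ t x : ℝ) : ℝ := τ * (Real.sinh (τ * W.φx t x) * W.φtx t x)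

/-- The space derivative of `c`. -/
def cx (τ t x : ℝ) : ℝ := τ * (Real.sinh (τ * W.φx t x) * W.φxx t x)

/-- The time derivative of `Q`. -/
def Qt (τ t x : ℝ) : ℝ := 2 * W.φt t x * W.φtt t x - 2 * W.m τ t x * W.φtx t x

/-- The space derivative of `Q`. -/
def Qx (τ t x : ℝ) : ℝ := 2 * W.φt t x * W.φtx t x - 2 * W.m τ t x * W.φxx t x

@[simp] lemma c_zero (t x : ℝ) : W.c 0 t x = 1 := by simp [c]
@[simp] lemma m_zero (t x : ℝ) : W.m 0 t x = W.φx t x := by simp [m]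
@[simp] lemma Q_zero (t x : ℝ) : W.Q 0 t x = W.φt t x ^ 2 - W.φx t x ^ 2 := by simp [Q]
@[simp] lemma ct_zero (t x : ℝ) : W.ct 0 t x = 0 := by simp [ct]
@[simp] lemma cx_zero (t x : ℝ) : W.cx 0 t x = 0 := by simp [cx]

section Continuity

variable {X : Type*} [TopologicalSpace X] {r a b : X → ℝ}

@[fun_prop] lemma continuous_c (hr : Continuous r) (ha : Continuous a) (hb : Continuous b) :
    Continuous fun q => W.c (r q) (a q) (b q) := by unfold c; fun_prop
@[fun_prop] lemma continuous_m (hr : Continuous r) (ha : Continuous a) (hb : Continuous b) :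
    Continuous fun q => W.m (r q) (a q) (b q) := by unfold m; fun_prop
@[fun_prop] lemma continuous_Q (hr : Continuous r) (ha : Continuous a) (hb : Continuous b) :
    Continuous fun q => W.Q (r q) (a q) (b q) := by unfold Q; fun_prop
@[fun_prop] lemma continuous_ct (hr : Continuous r) (ha : Continuous a) (hb : Continuous b) :
    Continuous fun q => W.ct (r q) (a q) (b q) := by unfold ct; fun_prop
@[fun_prop] lemma continuous_cx (hr : Continuous r) (ha : Continuous a) (hb : Continuous b) :
    Continuous fun q => W.cx (r q) (a q) (b q) := by unfold cx; fun_prop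
@[fun_prop] lemma continuous_Qt (hr : Continuous r) (ha : Continuous a) (hb : Continuous b) :
    Continuous fun q => W.Qt (r q) (a q) (b q) := by unfold Qt; fun_prop
@[fun_prop] lemma continuous_Qx (hr : Continuous r) (ha : Continuous a) (hb : Continuous b) :
    Continuous fun q => W.Qx (r q) (a q) (b q) := by unfold Qx; fun_prop

end Continuity

lemma m_eq {τ : ℝ} (hτ : τ ≠ 0) (t x : ℝ) : W.m τ t x = Real.sinh (τ * W.φx t x) / τ :=
  mul_sinhc_mul hτ _

lemma Q_eq {τ : ℝ} (hτ : τ ≠ 0) (t x : ℝ) :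
    W.Q τ t x = W.φt t x ^ 2 - 2 * (W.c τ t x - 1) / τ ^ 2 := by
  rw [Q, sq_mul_sinhc_half hτ, c]

lemma hasDerivAt_c_time (τ t x : ℝ) : HasDerivAt (fun r => W.c τ r x) (W.ct τ t x) t := by
  refine (((W.deriv_φtx t x).const_mul τ).cosh).congr_deriv ?_
  unfold ct; ring

lemma hasDerivAt_c_space (τ t x : ℝ) : HasDerivAt (fun y => W.c τ t y) (W.cx τ t x) x := by
  refine (((W.deriv_φxx t x).const_mul τ).cosh).congr_deriv ?_
  unfold cx; ring

lemma hasDerivAt_m_time {τ : ℝ} (hτ : τ ≠ 0) (t x : ℝ) :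
    HasDerivAt (fun r => W.m τ r x) (W.c τ t x * W.φtx t x) t := by
  simp only [W.m_eq hτ]
  refine (((W.deriv_φtx t x).const_mul τ).sinh.div_const τ).congr_deriv ?_
  unfold c; field_simp

lemma hasDerivAt_m_space {τ : ℝ} (hτ : τ ≠ 0) (t x : ℝ) :
    HasDerivAt (fun y => W.m τ t y) (W.c τ t x * W.φxx t x) x := by
  simp only [W.m_eq hτ]
  refine (((W.deriv_φxx t x).const_mul τ).sinh.div_const τ).congr_deriv ?_
  unfold c; field_simp

lemma hasDerivAt_Q_time {τ : ℝ} (hτ : τ ≠ 0) (t x : ℝ) :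
    HasDerivAt (fun r => W.Q τ r x) (W.Qt τ t x) t := by
  simp only [W.Q_eq hτ]
  refine (((W.deriv_φtt t x).pow 2).sub
    ((((W.hasDerivAt_c_time τ t x).sub_const 1).const_mul 2).div_const (τ ^ 2))).congr_deriv ?_
  rw [Qt, ct, W.m_eq hτ]; field_simp; ring

lemma hasDerivAt_Q_space {τ : ℝ} (hτ : τ ≠ 0) (t x : ℝ) :
    HasDerivAt (fun y => W.Q τ t y) (W.Qx τ t x) x := by
  simp only [W.Q_eq hτ]
  refine (((W.deriv_φxt t x).pow 2).sub
    ((((W.hasDerivAt_c_space τ t x).sub_const 1).const_mul 2).div_const (τ ^ 2))).congr_deriv ?_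
  rw [Qx, cx, W.m_eq hτ]; field_simp; ring

end CarlemanWeight

/-! ### Coercivity of the edge density -/

namespace CarlemanWeight

variable {T : ℝ} (W : CarlemanWeight T)

/-- The time derivative of `c φ_t`. -/
def cφtt (τ t x : ℝ) : ℝ := W.ct τ t x * W.φt t x + W.c τ t x * W.φtt t x

/-- The time derivative of `Q φ_t`. -/
def Qφtt (τ t x : ℝ) : ℝ := W.Qt τ t x * W.φt t x + W.Q τ t x * W.φtt t x

/-- The edge density of the conjugated operator for the weight `W` on the edge `[x, y]`. -/
def edge (k s τ t x y u u' v v' : ℝ) : ℝ :=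
  edgeDensity k s (W.φtt t x) (W.φtt t y) (W.m τ t x) (W.m τ t y)
    (W.c τ t x * W.φtx t x) (W.c τ t y * W.φtx t y) (W.θ t x) (W.θ t y) (W.θt t x) (W.θt t y)
    (W.c τ t x) (W.c τ t y) (W.Q τ t x) (W.Q τ t y) (W.φt t x) (W.φt t y)
    (W.cφtt τ t x) (W.cφtt τ t y) (W.Qφtt τ t x) (W.Qφtt τ t y) u u' v v'

-- Each half of the density is a small perturbation of the two pseudoconvexity conditions at its end
-- point. Of the two defect terms, the one in `s² (v' - v)²` equals `τ²` times the squared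
-- difference quotient and is absorbed; the one in `(u' - u)²` has no such gain and stays.
set_option maxHeartbeats 1000000 in
theorem exists_edge_lower_bound : ∃ C σ : ℝ, 0 < C ∧ 0 < σ ∧
    ∀ᶠ δ in nhdsWithin (0 : ℝ) (Ioi 0), ∀ h ∈ Ioc 0 δ, ∀ s, σ < s → s * h ≤ δ →
      ∀ t ∈ Icc (-T) T, ∀ x, 0 ≤ x → x + h ≤ 1 → ∀ u u' v v' : ℝ,
        W.κ / 2 * ((u ^ 2 + u' ^ 2) / 2 + s ^ 2 * ((v ^ 2 + v' ^ 2) / 2) + ((v' - v) * h⁻¹) ^ 2)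
          - C * (u' - u) ^ 2 ≤ W.edge h⁻¹ s (s * h) t x (x + h) u u' v v' := by
  have hκ := W.κ_pos
  -- Each half edge is used with `η = 3 ζ` and loses `9 ζ`; the `v`-defect costs another `ζ / 2`.
  -- Together this is less than `κ / 2 = 12 ζ`.
  obtain ⟨ζ, hζ0, hζ⟩ : ∃ ζ, 0 < ζ ∧ ζ = W.κ / 24 := ⟨_, by positivity, rfl⟩
  obtain ⟨C1, hC1, B1⟩ := exists_bound_of_continuous T
    (F := fun _ t x => W.φxx t x) (by fun_prop)
  obtain ⟨C2, hC2, B2⟩ := exists_bound_of_continuous T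
    (F := fun τ t x => W.Qx τ t x * W.m τ t x + W.Q τ t x * (W.c τ t x * W.φxx t x)) (by fun_prop)
  obtain ⟨C3, hC3, B3⟩ := exists_bound_of_continuous T
    (F := fun τ t x => W.cx τ t x * W.θ t x + W.c τ t x * W.θx t x) (by fun_prop)
  obtain ⟨C4, hC4, B4⟩ := exists_bound_of_continuous T
    (F := fun _ t x => W.θt t x) (by fun_prop)
  have H1 := eventually_slope_close T (f := W.m) (F := fun τ t x => W.c τ t x * W.φxx t x)
    (by fun_prop) (fun τ hτ t x => W.hasDerivAt_m_space hτ.ne' t x) hζ0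
  have H2 := eventually_slope_close T (f := fun τ t x => W.c τ t x * W.m τ t x)
    (F := fun τ t x => W.cx τ t x * W.m τ t x + W.c τ t x * (W.c τ t x * W.φxx t x)) (by fun_prop)
    (fun τ hτ t x => (W.hasDerivAt_c_space τ t x).mul (W.hasDerivAt_m_space hτ.ne' t x)) hζ0
  have H3 := eventually_slope_close T (f := fun τ t x => W.c τ t x * W.φt t x)
    (F := fun τ t x => W.cx τ t x * W.φt t x + W.c τ t x * W.φtx t x) (by fun_prop)
    (fun τ hτ t x => (W.hasDerivAt_c_space τ t x).mul (W.deriv_φxt t x)) hζ0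
  have H4 := eventually_slope_close T (f := fun τ t x => W.Q τ t x * W.m τ t x)
    (F := fun τ t x => W.Qx τ t x * W.m τ t x + W.Q τ t x * (W.c τ t x * W.φxx t x)) (by fun_prop)
    (fun τ hτ t x => (W.hasDerivAt_Q_space hτ.ne' t x).mul (W.hasDerivAt_m_space hτ.ne' t x)) hζ0
  have H5 := eventually_slope_close T (f := fun τ t x => W.c τ t x * W.θ t x)
    (F := fun τ t x => W.cx τ t x * W.θ t x + W.c τ t x * W.θx t x) (by fun_prop)
    (fun τ hτ t x => (W.hasDerivAt_c_space τ t x).mul (W.deriv_θx t x)) hζ0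
  have K1 := eventually_close_of_continuous T (F := W.cφtt) (by unfold cφtt; fun_prop) hζ0
  have K2 := eventually_close_of_continuous T (F := fun τ t x => W.c τ t x * W.θ t x)
    (by fun_prop) hζ0
  have K3 := eventually_close_of_continuous T (F := fun τ t x => W.c τ t x * W.φtx t x)
    (by fun_prop) hζ0
  have K4 := eventually_close_of_continuous T (F := W.Qφtt) (by unfold Qφtt; fun_prop) hζ0
  have K5 := eventually_close_of_continuous T (F := fun τ t x => W.Q τ t x * W.θ t x)
    (by fun_prop) hζ0
  have hsmall : ∀ᶠ δ in nhdsWithin (0 : ℝ) (Ioi 0), (C2 + ζ) * δ ^ 2 ≤ ζ := by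
    have : Filter.Tendsto (fun δ : ℝ => (C2 + ζ) * δ ^ 2) (nhdsWithin (0 : ℝ) (Ioi 0))
        (nhds ((C2 + ζ) * 0 ^ 2)) :=
      (Continuous.tendsto (by fun_prop) 0).mono_left nhdsWithin_le_nhds
    exact (this.eventually_lt_const (by simpa using hζ0)).mono fun _ h => h.le
  -- `C1 + ζ` bounds the slope of `m`. Beyond the second constant, `θ_t` and the slope of `c θ` are
  -- at most `ζ s`.
  refine ⟨(C1 + ζ) / 2, (C3 + C4 + ζ) / ζ, by positivity, by positivity, ?_⟩
  filter_upwards [H1, H2, H3, H4, H5, K1, K2, K3, K4, K5, hsmall] with δ H1 H2 H3 H4 H5 K1 K2 K3 K4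
    K5 hsmall h hh s hs hsh t ht x hx0 hx1 u u' v v'
  have hh0 := hh.1
  have hs0 : 0 < s := lt_trans (by positivity) hs
  have hsζ : C3 + C4 + ζ ≤ ζ * s := by
    rw [div_lt_iff₀ hζ0] at hs; linarith
  obtain ⟨τ, hτ⟩ : ∃ τ, τ = s * h := ⟨_, rfl⟩
  have hτm : τ ∈ Ioc 0 δ := ⟨by rw [hτ]; positivity, hτ.le.trans hsh⟩
  have hτ' : τ ∈ Icc 0 δ := ⟨hτm.1.le, hτm.2⟩
  rw [← hτ]
  have hx : x ∈ Icc (0 : ℝ) 1 := ⟨hx0, by linarith⟩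
  obtain ⟨y, hy⟩ : ∃ y, y = x + h := ⟨_, rfl⟩
  have hy1 : y ∈ Icc (0 : ℝ) 1 := ⟨by linarith, by linarith⟩
  have hd : |x - x| ≤ δ := by simpa using hh0.le.trans hh.2
  have hd' : |y - y| ≤ δ := by simpa using hh0.le.trans hh.2
  have z0 : (0 : ℝ) ∈ Icc (0 : ℝ) 1 := ⟨le_rfl, zero_le_one⟩
  have B1 := B1 0 z0 t ht x hx
  have B2 := B2 0 z0 t ht x hx
  have B3 := B3 0 z0 t ht x hx
  have B4x := B4 0 z0 t ht x hx
  have B4y := B4 0 z0 t ht y hy1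
  have H1 := H1 τ hτm t ht h hh x hx0 hx1
  have H2 := H2 τ hτm t ht h hh x hx0 hx1
  have H3 := H3 τ hτm t ht h hh x hx0 hx1
  have H4 := H4 τ hτm t ht h hh x hx0 hx1
  have H5 := (H5 τ hτm t ht h hh x hx0 hx1).1
  have K1x := K1 τ hτ' t ht x hx x hx hd
  have K1y := K1 τ hτ' t ht y hy1 y hy1 hd'
  have K2x := K2 τ hτ' t ht x hx x hx hd
  have K2y := K2 τ hτ' t ht y hy1 y hy1 hd'
  have K3x := K3 τ hτ' t ht x hx x hx hd
  have K3y := K3 τ hτ' t ht y hy1 y hy1 hd'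
  have K4x := K4 τ hτ' t ht x hx x hx hd
  have K4y := K4 τ hτ' t ht y hy1 y hy1 hd'
  have K5x := K5 τ hτ' t ht x hx x hx hd
  have K5y := K5 τ hτ' t ht y hy1 y hy1 hd'
  have P1x := W.pseudoconvex t ht x hx u ((v' - v) * h⁻¹)
  have P1y := W.pseudoconvex t ht y hy1 u' ((v' - v) * h⁻¹)
  have P2x := W.pseudoconvex_zero t ht x hx
  have P2y := W.pseudoconvex_zero t ht y hy1
  rw [← hy] at H1 H2 H3 H4 H5 ⊢
  simp only [cφtt, Qφtt, Qt, Qx, c_zero, m_zero, Q_zero, ct_zero, cx_zero, zero_mul, one_mul,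
    zero_add] at H1 H2 H3 H4 H5 K1x K1y K2x K2y K3x K3y K4x K4y K5x K5y B1 B2 B3
  simp only [edge, edgeDensity, cφtt, Qφtt, Qt]
  rw [abs_le] at B1 B2 B3 B4x B4y H5 K1x K1y K2x K2y K3x K3y K4x K4y K5x K5y
  simp only [abs_le] at H1 H2 H3 H4
  have Lx := half_edge_lower_bound (η := 3 * ζ) (v := v) hs0 P1x P2x
    (A := W.φtt t x + W.θ t x + (W.m τ t y - W.m τ t x) * h⁻¹)
    (B := (W.ct τ t x * W.φt t x + W.c τ t x * W.φtt t x)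
      + (W.c τ t y * W.m τ t y - W.c τ t x * W.m τ t x) * h⁻¹ - W.c τ t x * W.θ t x)
    (E := W.c τ t x * W.φtx t x + (W.c τ t y * W.φt t y - W.c τ t x * W.φt t x) * h⁻¹)
    (G := ((2 * W.φt t x * W.φtt t x - 2 * W.m τ t x * W.φtx t x) * W.φt t x
      + W.Q τ t x * W.φtt t x) - W.Q τ t x * W.θ t x
      - (W.Q τ t y * W.m τ t y - W.Q τ t x * W.m τ t x) * h⁻¹)
    (F := W.θt t x) (D := (W.c τ t y * W.θ t y - W.c τ t x * W.θ t x) * h⁻¹)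
    (by rw [abs_le]; constructor <;> linarith [H1.1.1, H1.1.2])
    (by rw [abs_le]; constructor <;> linarith [H2.1.1, H2.1.2])
    (by rw [abs_le]; constructor <;> linarith [H3.1.1, H3.1.2])
    (by rw [abs_le]; constructor <;> linarith [H4.1.1, H4.1.2])
    (by rw [abs_le]; constructor <;> linarith)
    (by rw [abs_le]; constructor <;> linarith)
  have Ly := half_edge_lower_bound (η := 3 * ζ) (v := v') hs0 P1y P2y
    (A := W.φtt t y + W.θ t y + (W.m τ t y - W.m τ t x) * h⁻¹)
    (B := (W.ct τ t y * W.φt t y + W.c τ t y * W.φtt t y)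
      + (W.c τ t y * W.m τ t y - W.c τ t x * W.m τ t x) * h⁻¹ - W.c τ t y * W.θ t y)
    (E := W.c τ t y * W.φtx t y + (W.c τ t y * W.φt t y - W.c τ t x * W.φt t x) * h⁻¹)
    (G := ((2 * W.φt t y * W.φtt t y - 2 * W.m τ t y * W.φtx t y) * W.φt t y
      + W.Q τ t y * W.φtt t y) - W.Q τ t y * W.θ t y
      - (W.Q τ t y * W.m τ t y - W.Q τ t x * W.m τ t x) * h⁻¹)
    (F := W.θt t y) (D := (W.c τ t y * W.θ t y - W.c τ t x * W.θ t x) * h⁻¹)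
    (by rw [abs_le]; constructor <;> linarith [H1.2.1, H1.2.2])
    (by rw [abs_le]; constructor <;> linarith [H2.2.1, H2.2.2])
    (by rw [abs_le]; constructor <;> linarith [H3.2.1, H3.2.2])
    (by rw [abs_le]; constructor <;> linarith [H4.2.1, H4.2.2])
    (by rw [abs_le]; constructor <;> linarith)
    (by rw [abs_le]; constructor <;> linarith)
  have M1 : (W.m τ t y - W.m τ t x) * h⁻¹ * (u' - u) ^ 2 ≤ (C1 + ζ) * (u' - u) ^ 2 :=
    mul_le_mul_of_nonneg_right (by linarith [H1.1.2]) (sq_nonneg _)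
  have hdd : s ^ 2 * (v' - v) ^ 2 = τ ^ 2 * ((v' - v) * h⁻¹) ^ 2 := by
    rw [hτ]; field_simp
  have hτ2 : (C2 + ζ) * τ ^ 2 ≤ ζ :=
    (mul_le_mul_of_nonneg_left (pow_le_pow_left₀ hτm.1.le hτm.2 2) (by positivity)).trans hsmall
  have M2 : -(ζ * ((v' - v) * h⁻¹) ^ 2) ≤ s ^ 2 * ((W.Q τ t y * W.m τ t y
      - W.Q τ t x * W.m τ t x) * h⁻¹) * (v' - v) ^ 2 := by
    have h1 : -(C2 + ζ) * (s ^ 2 * (v' - v) ^ 2) ≤ ((W.Q τ t y * W.m τ t y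
      - W.Q τ t x * W.m τ t x) * h⁻¹) * (s ^ 2 * (v' - v) ^ 2) :=
      mul_le_mul_of_nonneg_right (by linarith [H4.1.1]) (by positivity)
    have h2 : (C2 + ζ) * τ ^ 2 * ((v' - v) * h⁻¹) ^ 2 ≤ ζ * ((v' - v) * h⁻¹) ^ 2 :=
      mul_le_mul_of_nonneg_right hτ2 (sq_nonneg _)
    rw [hdd] at h1
    calc _ ≤ -(C2 + ζ) * (τ ^ 2 * ((v' - v) * h⁻¹) ^ 2) := by linarith
      _ ≤ _ := h1
      _ = _ := by rw [← hdd]; ring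
  have N1 := mul_nonneg hζ0.le (sq_nonneg ((v' - v) * h⁻¹))
  have N2 := mul_nonneg hζ0.le (sq_nonneg u)
  have N3 := mul_nonneg hζ0.le (sq_nonneg u')
  have N4 := mul_nonneg hζ0.le (mul_nonneg (sq_nonneg s) (sq_nonneg v))
  have N5 := mul_nonneg hζ0.le (mul_nonneg (sq_nonneg s) (sq_nonneg v'))
  have hκζ : W.κ = 24 * ζ := by linarith
  rw [hκζ] at Lx Ly ⊢
  linarith

end CarlemanWeight

/-! ### Comparison of the exponential weights at neighbouring nodes -/

/-- The tangent line inequality `e^y ≥ e^x (1 + y - x)`, used in both directions. -/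
lemma abs_exp_sub_exp_le {a b B : ℝ} (ha : |a| ≤ B) (hb : |b| ≤ B) :
    |Real.exp a - Real.exp b| ≤ Real.exp B * |a - b| := by
  have key : ∀ x y : ℝ, |x| ≤ B → Real.exp x - Real.exp y ≤ Real.exp B * |x - y| := by
    intro x y hx
    have h1 : Real.exp x * (y - x + 1) ≤ Real.exp y := by
      calc _ ≤ Real.exp x * Real.exp (y - x) :=
            mul_le_mul_of_nonneg_left (Real.add_one_le_exp _) (Real.exp_pos _).le
        _ = _ := by rw [← Real.exp_add]; congr 1; ring
    calc _ ≤ Real.exp x * (x - y) := by linarith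
      _ ≤ Real.exp x * |x - y| := mul_le_mul_of_nonneg_left (le_abs_self _) (Real.exp_pos _).le
      _ ≤ _ := mul_le_mul_of_nonneg_right (Real.exp_le_exp.2 ((le_abs_self _).trans hx))
        (abs_nonneg _)
  rw [abs_le]
  have h1 := key a b ha
  have h2 := key b a hb
  rw [abs_sub_comm] at h2
  constructor <;> linarith

namespace CarlemanWeight

variable {T : ℝ} (W : CarlemanWeight T)

/-- Bounds, on an edge `[x, x + h]`, for the ratio of the exponential weights at the end points and
for the coefficients of the conjugated operator. -/
theorem exists_edge_bounds : ∃ C : ℝ, 1 ≤ C ∧ ∀ h s t x : ℝ, 0 < h → 0 < s → s * h ≤ 1 →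
    t ∈ Icc (-T) T → 0 ≤ x → x + h ≤ 1 →
    |Real.exp (s * (W.φ t x - W.φ t (x + h)))| ≤ C ∧
    |Real.exp (s * (W.φ t x - W.φ t (x + h))) - 1| ≤ C * (s * h) ∧
    |Real.exp (s * (W.φ t x - W.φ t (x + h))) - Real.exp (-(s * h * W.φx t x))| ≤
      C * s * h ^ 2 ∧
    |Real.exp (s * (W.φ t (x + h) - W.φ t x)) - Real.exp (s * h * W.φx t (x + h))| ≤
      C * s * h ^ 2 ∧
    |W.φt t (x + h) - W.φt t x| ≤ C * h ∧
    (∀ y ∈ Icc (0 : ℝ) 1, |W.φt t y| ≤ C ∧ |W.θ t y - W.φtt t y| ≤ C ∧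
      |W.c (s * h) t y * W.m (s * h) t y| ≤ C) := by
  obtain ⟨A, hA, BA⟩ := exists_bound_of_continuous T (F := fun _ t x => W.φx t x) (by fun_prop)
  obtain ⟨C1, hC1, B1⟩ := exists_bound_of_continuous T (F := fun _ t x => W.φxx t x) (by fun_prop)
  obtain ⟨C2, hC2, B2⟩ := exists_bound_of_continuous T (F := fun _ t x => W.φtx t x) (by fun_prop)
  obtain ⟨C3, hC3, B3⟩ := exists_bound_of_continuous T (F := fun _ t x => W.φt t x) (by fun_prop)
  obtain ⟨C4, hC4, B4⟩ := exists_bound_of_continuous T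
    (F := fun _ t x => W.θ t x - W.φtt t x) (by fun_prop)
  obtain ⟨C5, hC5, B5⟩ := exists_bound_of_continuous T
    (F := fun τ t x => W.c τ t x * W.m τ t x) (by fun_prop)
  have hE := Real.exp_pos A
  refine ⟨1 + Real.exp A * (1 + A + C1) + C2 + C3 + C4 + C5, by nlinarith [mul_pos hE hA, mul_pos hE hC1], ?_⟩
  intro h s t x hh hs hsh ht hx0 hx1
  have z0 : (0 : ℝ) ∈ Icc (0 : ℝ) 1 := ⟨le_rfl, zero_le_one⟩
  have hτ0 : 0 < s * h := mul_pos hs hh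
  have hx : x ∈ Icc (0 : ℝ) 1 := ⟨hx0, by linarith⟩
  have hy : x + h ∈ Icc (0 : ℝ) 1 := ⟨by linarith, hx1⟩
  have mvt : ∀ {f F : ℝ → ℝ} {B : ℝ}, (∀ z, HasDerivAt f (F z) z) →
      (∀ z ∈ Icc (0 : ℝ) 1, |F z| ≤ B) → ∀ a ∈ Icc (0 : ℝ) 1, ∀ b ∈ Icc (0 : ℝ) 1,
      |f b - f a| ≤ B * |b - a| := by
    intro f F B hf hF a ha b hb
    exact (convex_Icc (0 : ℝ) 1).norm_image_sub_le_of_norm_hasDerivWithin_le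
      (fun z _ => (hf z).hasDerivWithinAt) hF ha hb
  have lipφ := mvt (W.deriv_φx t) (BA 0 z0 t ht) x hx (x + h) hy
  rw [add_sub_cancel_left, abs_of_pos hh] at lipφ
  have lipφx := mvt (W.deriv_φxx t) (B1 0 z0 t ht)
  have lipφt := mvt (W.deriv_φxt t) (B2 0 z0 t ht) x hx (x + h) hy
  rw [add_sub_cancel_left, abs_of_pos hh] at lipφt
  obtain ⟨ξ, hξ, e⟩ := exists_slope_eq (W.deriv_φx t) hh (x := x)
  have hξ' : ξ ∈ Icc (0 : ℝ) 1 := ⟨by linarith [hξ.1], by linarith [hξ.2]⟩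
  have e' : W.φ t (x + h) - W.φ t x = W.φx t ξ * h := by rw [← e]; field_simp
  have n1 : |s * (W.φ t x - W.φ t (x + h))| ≤ A * (s * h) := by
    rw [abs_mul, abs_of_pos hs, abs_sub_comm]
    calc _ ≤ s * (A * h) := mul_le_mul_of_nonneg_left lipφ hs.le
      _ = _ := by ring
  have n1' : |s * (W.φ t (x + h) - W.φ t x)| ≤ A * (s * h) := by
    rw [← abs_neg]; convert n1 using 2; ring
  have nA : A * (s * h) ≤ A := by nlinarith
  have n2 : ∀ y ∈ Icc (0 : ℝ) 1, |s * h * W.φx t y| ≤ A := by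
    intro y hy
    rw [abs_mul, abs_of_pos hτ0]
    calc _ ≤ 1 * A := mul_le_mul hsh (BA 0 z0 t ht y hy) (abs_nonneg _) zero_le_one
      _ = A := one_mul _
  -- The exponent equals `s h φ_x` at an intermediate point, so moving that point inside the edge
  -- costs `s h · h`. This second power of `h` later cancels the `h⁻²` of the Laplacian.
  have n3 : ∀ y ∈ Icc x (x + h),
      |s * (W.φ t (x + h) - W.φ t x) - s * h * W.φx t y| ≤ C1 * s * h ^ 2 := by
    intro y hy
    have hy' : y ∈ Icc (0 : ℝ) 1 := ⟨by linarith [hy.1], by linarith [hy.2]⟩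
    have h1 := lipφx y hy' ξ hξ'
    have h2 : |ξ - y| ≤ h := by
      rw [abs_le]; constructor <;> linarith [hy.1, hy.2, hξ.1, hξ.2]
    rw [e', show s * (W.φx t ξ * h) - s * h * W.φx t y = s * h * (W.φx t ξ - W.φx t y) by ring,
      abs_mul, abs_of_pos hτ0]
    calc _ ≤ s * h * (C1 * h) :=
          mul_le_mul_of_nonneg_left (h1.trans (mul_le_mul_of_nonneg_left h2 hC1.le)) hτ0.le
      _ = _ := by ring
  have hEA := mul_pos hE hA
  have hEC := mul_pos hE hC1
  have big : ∀ {X Y : ℝ}, 0 ≤ Y → X ≤ Real.exp A * C1 * Y →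
      X ≤ (1 + Real.exp A * (1 + A + C1) + C2 + C3 + C4 + C5) * Y := by
    intro X Y hY hX
    refine hX.trans (mul_le_mul_of_nonneg_right ?_ hY)
    linarith
  refine ⟨?_, ?_, ?_, ?_, ?_, fun y hy => ⟨?_, ?_, ?_⟩⟩
  · rw [abs_of_pos (Real.exp_pos _)]
    have := Real.exp_le_exp.2 ((le_abs_self _).trans (n1.trans nA))
    linarith
  · have := abs_exp_sub_exp_le (n1.trans nA) (b := 0) (by simpa using hA.le)
    rw [Real.exp_zero, sub_zero] at this
    calc _ ≤ Real.exp A * (A * (s * h)) := this.trans (mul_le_mul_of_nonneg_left n1 hE.le)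
      _ = Real.exp A * A * (s * h) := by ring
      _ ≤ _ := mul_le_mul_of_nonneg_right (by linarith) hτ0.le
  · have := abs_exp_sub_exp_le (n1.trans nA) (b := -(s * h * W.φx t x))
      (by rw [abs_neg]; exact n2 x hx)
    have h3 := n3 x ⟨le_rfl, by linarith⟩
    rw [← abs_neg] at h3
    rw [mul_assoc _ s (h ^ 2)]
    refine big (by positivity) (this.trans ?_)
    rw [mul_assoc (Real.exp A), ← mul_assoc C1]
    refine mul_le_mul_of_nonneg_left (le_of_eq_of_le ?_ h3) hE.le
    congr 1; ring
  · have := abs_exp_sub_exp_le (n1'.trans nA) (n2 (x + h) hy)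
    have h3 := n3 (x + h) ⟨by linarith, le_rfl⟩
    rw [mul_assoc _ s (h ^ 2)]
    refine big (by positivity) (this.trans ?_)
    rw [mul_assoc (Real.exp A), ← mul_assoc C1]
    exact mul_le_mul_of_nonneg_left h3 hE.le
  · exact lipφt.trans (mul_le_mul_of_nonneg_right (by linarith) hh.le)
  · have := B3 0 z0 t ht y hy
    linarith
  · have := B4 0 z0 t ht y hy
    linarith
  · have := B5 (s * h) ⟨hτ0.le, hsh⟩ t ht y hy
    linarith

end CarlemanWeight

/-! ### Grid points and elementary sums -/

lemma mesh_pos (N : ℕ) : 0 < mesh N := by unfold mesh; positivity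

lemma node_succ (N j : ℕ) : node N (j + 1) = node N j + mesh N := by
  unfold node; push_cast; ring

lemma node_nonneg (N j : ℕ) : 0 ≤ node N j := by
  have := mesh_pos N
  unfold node; positivity

lemma node_last (N : ℕ) : node N (N + 1) = 1 := by
  unfold node mesh; push_cast; field_simp

lemma node_le_one {N j : ℕ} (hj : j ≤ N + 1) : node N j ≤ 1 := by
  rw [← node_last N]
  unfold node
  exact mul_le_mul_of_nonneg_right (by exact_mod_cast hj) (mesh_pos N).le

section Sums

variable {N : ℕ} {f : ℕ → ℝ}

lemma sum_range_eq_sum_Icc (h0 : f 0 = 0) :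
    ∑ j ∈ Finset.range (N + 1), f j = ∑ j ∈ Finset.Icc 1 N, f j := by
  rw [sum_nodes_eq_sum_edges (l := f) (r := fun _ => 0) (fun j => by simp)]
  simp [h0]

lemma sum_range_succ_eq_sum_Icc (h1 : f (N + 1) = 0) :
    ∑ j ∈ Finset.range (N + 1), f (j + 1) = ∑ j ∈ Finset.Icc 1 N, f j := by
  rw [sum_nodes_eq_sum_edges (l := fun _ => 0) (r := fun j => f (j + 1)) (fun j => by simp)]
  simp [h1]

lemma sum_Icc_succ_le (hf : ∀ j, 0 ≤ f j) (h1 : f (N + 1) = 0) :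
    ∑ j ∈ Finset.Icc 1 N, f (j + 1) ≤ ∑ j ∈ Finset.Icc 1 N, f j := by
  rw [← sum_range_succ_eq_sum_Icc h1]
  refine Finset.sum_le_sum_of_subset_of_nonneg (fun j hj => ?_) fun _ _ _ => hf _
  simp only [Finset.mem_Icc, Finset.mem_range] at *; omega

lemma sum_Icc_pred_le (hf : ∀ j, 0 ≤ f j) (h0 : f 0 = 0) :
    ∑ j ∈ Finset.Icc 1 N, f (j - 1) ≤ ∑ j ∈ Finset.Icc 1 N, f j := by
  rw [sum_nodes_eq_sum_edges (l := fun _ => 0) (r := f) (fun j => by simp),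
    ← sum_range_eq_sum_Icc h0]
  simp only [zero_add, sub_zero]
  linarith [hf N]

end Sums

lemma sq_add_three_le (a b c : ℝ) : (a + b + c) ^ 2 ≤ 3 * (a ^ 2 + b ^ 2 + c ^ 2) := by
  nlinarith [sq_nonneg (a - b), sq_nonneg (b - c), sq_nonneg (a - c)]

lemma sq_add_five_le (a b c d e : ℝ) :
    (a + b + c + d + e) ^ 2 ≤ 5 * (a ^ 2 + b ^ 2 + c ^ 2 + d ^ 2 + e ^ 2) := by
  have h1 := sq_nonneg (a - b)
  have h2 := sq_nonneg (a - c)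
  have h3 := sq_nonneg (a - d)
  have h4 := sq_nonneg (a - e)
  have h5 := sq_nonneg (b - c)
  have h6 := sq_nonneg (b - d)
  have h7 := sq_nonneg (b - e)
  have h8 := sq_nonneg (c - d)
  have h9 := sq_nonneg (c - e)
  have h10 := sq_nonneg (d - e)
  linarith

lemma sq_mul_le_of_abs_le {a b x : ℝ} (h : |a| ≤ b) : (a * x) ^ 2 ≤ b ^ 2 * x ^ 2 := by
  rw [mul_pow]
  exact mul_le_mul_of_nonneg_right (sq_le_sq' (abs_le.1 h).1 (abs_le.1 h).2) (sq_nonneg x)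

/-! ### The conjugated wave operator -/

namespace CarlemanWeight

variable {T : ℝ} (W : CarlemanWeight T)

/-- The time derivative of the energy of `(v, u)` if `u = ∂_t v` and `z = ∂_t u`. -/
def energyRate (N : ℕ) (s t : ℝ) (v u z : ℕ → ℝ) : ℝ :=
  ∑ j ∈ Finset.Icc 1 N,
      (-W.φtt t (node N j) * u j ^ 2 - 2 * W.φt t (node N j) * u j * z j
        + 2 * (W.c (s * mesh N) t (node N j) * W.φtx t (node N j)) * u j
          * ((v (j + 1) - v (j - 1)) * (mesh N)⁻¹ / 2)
        + 2 * W.m (s * mesh N) t (node N j) * z j * ((v (j + 1) - v (j - 1)) * (mesh N)⁻¹ / 2)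
        + 2 * W.m (s * mesh N) t (node N j) * u j * ((u (j + 1) - u (j - 1)) * (mesh N)⁻¹ / 2)
        - W.θt t (node N j) * v j * u j - W.θ t (node N j) * u j ^ 2 - W.θ t (node N j) * v j * z j
        - s ^ 2 * W.Qφtt (s * mesh N) t (node N j) * v j ^ 2
        - 2 * s ^ 2 * (W.Q (s * mesh N) t (node N j) * W.φt t (node N j)) * v j * u j)
    - ∑ j ∈ Finset.range (N + 1),
        ((W.cφtt (s * mesh N) t (node N j) + W.cφtt (s * mesh N) t (node N (j + 1))) / 2
            * ((v (j + 1) - v j) * (mesh N)⁻¹) ^ 2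
          + (W.c (s * mesh N) t (node N j) * W.φt t (node N j)
              + W.c (s * mesh N) t (node N (j + 1)) * W.φt t (node N (j + 1)))
            * ((v (j + 1) - v j) * (mesh N)⁻¹) * ((u (j + 1) - u j) * (mesh N)⁻¹))

/-- The second order part of the conjugated wave operator. -/
def conjMain (N : ℕ) (s t : ℝ) (v z : ℕ → ℝ) (j : ℕ) : ℝ :=
  z j - W.c (s * mesh N) t (node N j) * ((v (j + 1) - 2 * v j + v (j - 1)) * (mesh N)⁻¹ ^ 2)
    + s ^ 2 * W.Q (s * mesh N) t (node N j) * v j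

/-- The first order part of the conjugated wave operator, divided by `s`. -/
def conjMult (N : ℕ) (s t : ℝ) (v u : ℕ → ℝ) (j : ℕ) : ℝ :=
  -2 * W.φt t (node N j) * u j
    + 2 * W.m (s * mesh N) t (node N j) * ((v (j + 1) - v (j - 1)) * (mesh N)⁻¹ / 2)
    - W.θ t (node N j) * v j

/-- The conjugated function `e^{sφ} w`. -/
def conj (N : ℕ) (s t : ℝ) (w : ℕ → ℝ) (j : ℕ) : ℝ := Real.exp (s * W.φ t (node N j)) * w j

/-- The time derivative of `e^{sφ} w`, where `w' = ∂_t w`. -/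
def conjt (N : ℕ) (s t : ℝ) (w w' : ℕ → ℝ) (j : ℕ) : ℝ :=
  Real.exp (s * W.φ t (node N j)) * (w' j + s * W.φt t (node N j) * w j)

/-- The second time derivative of `e^{sφ} w`, where `w' = ∂_t w` and `w'' = ∂_tt w`. -/
def conjtt (N : ℕ) (s t : ℝ) (w w' w'' : ℕ → ℝ) (j : ℕ) : ℝ :=
  Real.exp (s * W.φ t (node N j)) * (w'' j + 2 * s * W.φt t (node N j) * w' j
    + (s ^ 2 * W.φt t (node N j) ^ 2 + s * W.φtt t (node N j)) * w j)

lemma exp_node_eq (N : ℕ) (s t : ℝ) (i j : ℕ) :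
    Real.exp (s * W.φ t (node N i)) =
      Real.exp (s * (W.φ t (node N i) - W.φ t (node N j))) * Real.exp (s * W.φ t (node N j)) := by
  rw [← Real.exp_add]; congr 1; ring

/-- Replacing the exact neighbour ratios `e^{s(φ_j - φ_{j±1})}` by `e^{∓τφ_x} = c ∓ τ m` produces
exactly the coefficients `c`, `m` and `Q`. What is left is the error of this replacement and the
exchange of `φ_tt` for `θ`. The index `i + 1` avoids truncated subtraction. -/
lemma conj_remainder_eq {N : ℕ} {s : ℝ} (hs : 0 < s) (t : ℝ) (w w' w'' : ℕ → ℝ) (i : ℕ) :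
    Real.exp (s * W.φ t (node N (i + 1))) * (w'' (i + 1) - lap N w (i + 1))
      - W.conjMain N s t (W.conj N s t w) (W.conjtt N s t w w' w'') (i + 1)
      - s * W.conjMult N s t (W.conj N s t w) (W.conjt N s t w w') (i + 1) =
    -((mesh N)⁻¹ ^ 2 * (Real.exp (s * (W.φ t (node N (i + 1)) - W.φ t (node N (i + 2))))
        - Real.exp (-(s * mesh N * W.φx t (node N (i + 1)))))) * W.conj N s t w (i + 2)
    + -((mesh N)⁻¹ ^ 2 * (Real.exp (s * (W.φ t (node N (i + 1)) - W.φ t (node N i)))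
        - Real.exp (s * mesh N * W.φx t (node N (i + 1))))) * W.conj N s t w i
    + s * (W.θ t (node N (i + 1)) - W.φtt t (node N (i + 1))) * W.conj N s t w (i + 1) := by
  have hh := mesh_pos N
  have hτ : s * mesh N ≠ 0 := by positivity
  have e1 : Real.exp (s * (W.φ t (node N (i + 1)) - W.φ t (node N (i + 2))))
      * W.conj N s t w (i + 2) = Real.exp (s * W.φ t (node N (i + 1))) * w (i + 2) := by
    rw [conj, ← mul_assoc, ← W.exp_node_eq]
  have e2 : Real.exp (s * (W.φ t (node N (i + 1)) - W.φ t (node N i)))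
      * W.conj N s t w i = Real.exp (s * W.φ t (node N (i + 1))) * w i := by
    rw [conj, ← mul_assoc, ← W.exp_node_eq]
  have e3 : Real.exp (s * mesh N * W.φx t (node N (i + 1)))
      = W.c (s * mesh N) t (node N (i + 1))
        + s * mesh N * W.m (s * mesh N) t (node N (i + 1)) := by
    rw [W.m_eq hτ, c, mul_div_cancel₀ _ hτ, Real.cosh_add_sinh]
  have e4 : Real.exp (-(s * mesh N * W.φx t (node N (i + 1))))
      = W.c (s * mesh N) t (node N (i + 1))
        - s * mesh N * W.m (s * mesh N) t (node N (i + 1)) := by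
    rw [W.m_eq hτ, c, mul_div_cancel₀ _ hτ, Real.cosh_sub_sinh]
  have e5 : s ^ 2 * W.Q (s * mesh N) t (node N (i + 1)) = s ^ 2 * W.φt t (node N (i + 1)) ^ 2
      - 2 * (W.c (s * mesh N) t (node N (i + 1)) - 1) * (mesh N)⁻¹ ^ 2 := by
    rw [W.Q_eq hτ]; field_simp
  have e6 : s * mesh N * (mesh N)⁻¹ = s := by field_simp
  have e7 : W.conj N s t w (i + 1) = Real.exp (s * W.φ t (node N (i + 1))) * w (i + 1) := rfl
  rw [e3, e4, conjMain, conjMult, conjt, conjtt, lap, e5, div_eq_mul_inv, ← inv_pow]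
  simp only [Nat.add_sub_cancel, add_assoc, Nat.reduceAdd]
  rw [e7]
  linear_combination (mesh N)⁻¹ ^ 2 * e1 + (mesh N)⁻¹ ^ 2 * e2
    + W.m (s * mesh N) t (node N (i + 1)) * (mesh N)⁻¹ * (W.conj N s t w (i + 2)
      - W.conj N s t w i) * e6

end CarlemanWeight

/-! ### Passage between `w` and the conjugated function -/

/-- The weighted discrete energy controlled by the Carleman estimate. -/
def totalEnergy (N : ℕ) (s : ℝ) (v u : ℕ → ℝ) : ℝ :=
  ∑ j ∈ Finset.Icc 1 N, u j ^ 2 + s ^ 2 * ∑ j ∈ Finset.Icc 1 N, v j ^ 2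
    + ∑ j ∈ Finset.range (N + 1), ((v (j + 1) - v j) * (mesh N)⁻¹) ^ 2

namespace CarlemanWeight

variable {T : ℝ} (W : CarlemanWeight T)

/-- The replacement errors are `O(s h²)` against a factor `h⁻²`, so all coefficients of the
remainder are `O(s)`. Its square is then one power of `s` below the coercive term `s · s² |v|²`. -/
theorem exists_remainder_bound : ∃ C : ℝ, 0 < C ∧ ∀ N s t, 0 < s → s * mesh N ≤ 1 →
    t ∈ Icc (-T) T → ∀ w w' w'' : ℕ → ℝ, w 0 = 0 → w (N + 1) = 0 →
    ∑ j ∈ Finset.Icc 1 N, (Real.exp (s * W.φ t (node N j)) * (w'' j - lap N w j)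
      - W.conjMain N s t (W.conj N s t w) (W.conjtt N s t w w' w'') j
      - s * W.conjMult N s t (W.conj N s t w) (W.conjt N s t w w') j) ^ 2
      ≤ C * (s ^ 2 * ∑ j ∈ Finset.Icc 1 N, W.conj N s t w j ^ 2) := by
  obtain ⟨C, hC, hB⟩ := W.exists_edge_bounds
  refine ⟨9 * C ^ 2, by positivity, fun N s t hs hsh ht w w' w'' hw0 hw1 => ?_⟩
  have hh := mesh_pos N
  have hv0 : W.conj N s t w 0 ^ 2 = 0 := by simp [conj, hw0]
  have hv1 : W.conj N s t w (N + 1) ^ 2 = 0 := by simp [conj, hw1]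
  have key : ∀ j ∈ Finset.Icc 1 N, (Real.exp (s * W.φ t (node N j)) * (w'' j - lap N w j)
      - W.conjMain N s t (W.conj N s t w) (W.conjtt N s t w w' w'') j
      - s * W.conjMult N s t (W.conj N s t w) (W.conjt N s t w w') j) ^ 2
      ≤ 3 * C ^ 2 * s ^ 2 * (W.conj N s t w (j + 1) ^ 2 + W.conj N s t w (j - 1) ^ 2
        + W.conj N s t w j ^ 2) := by
    intro j hj
    obtain ⟨i, rfl⟩ : ∃ i, j = i + 1 := ⟨j - 1, by rw [Finset.mem_Icc] at hj; omega⟩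
    rw [Finset.mem_Icc] at hj
    rw [W.conj_remainder_eq hs]
    have b1 := (hB (mesh N) s t (node N (i + 1)) hh hs hsh ht (node_nonneg _ _)
      (by rw [← node_succ]; exact node_le_one (by omega))).2.2.1
    have b2 := (hB (mesh N) s t (node N i) hh hs hsh ht (node_nonneg _ _)
      (by rw [← node_succ]; exact node_le_one (by omega))).2.2.2.1
    have b3 := ((hB (mesh N) s t (node N i) hh hs hsh ht (node_nonneg _ _)
      (by rw [← node_succ]; exact node_le_one (by omega))).2.2.2.2.2 (node N (i + 1))
        ⟨node_nonneg _ _, node_le_one (by omega)⟩).2.1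
    rw [← node_succ] at b1 b2
    have scale : ∀ {x : ℝ}, |x| ≤ C * s * mesh N ^ 2 → |-((mesh N)⁻¹ ^ 2 * x)| ≤ C * s := by
      intro x hx
      rw [abs_neg, abs_mul, abs_of_pos (by positivity)]
      calc _ ≤ (mesh N)⁻¹ ^ 2 * (C * s * mesh N ^ 2) :=
            mul_le_mul_of_nonneg_left hx (by positivity)
        _ = C * s := by field_simp
    have b3' : |s * (W.θ t (node N (i + 1)) - W.φtt t (node N (i + 1)))| ≤ C * s := by
      rw [abs_mul, abs_of_pos hs, mul_comm]
      exact mul_le_mul_of_nonneg_right b3 hs.le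
    refine (sq_add_three_le _ _ _).trans ?_
    have c1 := sq_mul_le_of_abs_le (x := W.conj N s t w (i + 2)) (scale b1)
    have c2 := sq_mul_le_of_abs_le (x := W.conj N s t w i) (scale b2)
    have c3 := sq_mul_le_of_abs_le (x := W.conj N s t w (i + 1)) b3'
    simp only [Nat.add_sub_cancel, add_assoc, Nat.reduceAdd] at c1 c2 c3 ⊢
    calc _ ≤ 3 * ((C * s) ^ 2 * W.conj N s t w (i + 2) ^ 2 + ((C * s) ^ 2 * W.conj N s t w i ^ 2
          + (C * s) ^ 2 * W.conj N s t w (i + 1) ^ 2)) := by gcongr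
      _ = _ := by ring
  refine (Finset.sum_le_sum key).trans ?_
  rw [← Finset.mul_sum, Finset.sum_add_distrib, Finset.sum_add_distrib]
  have d1 := sum_Icc_succ_le (f := fun j => W.conj N s t w j ^ 2) (fun j => sq_nonneg _) hv1
  have d2 := sum_Icc_pred_le (N := N) (f := fun j => W.conj N s t w j ^ 2)
    (fun j => sq_nonneg _) hv0
  calc _ ≤ 3 * C ^ 2 * s ^ 2 * (∑ j ∈ Finset.Icc 1 N, W.conj N s t w j ^ 2
      + ∑ j ∈ Finset.Icc 1 N, W.conj N s t w j ^ 2 + ∑ j ∈ Finset.Icc 1 N, W.conj N s t w j ^ 2) := by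
        gcongr
    _ = _ := by ring

/-- The increment of `u` is the weighted increment of `w'` plus terms carrying a factor `τ`: the
weight ratio differs from one by `O(τ)`, `s (v_{j+1} - v_j)` is `τ` times the difference quotient,
and `s` times the increment of `φ_t` is `O(τ)`. In the last term `s ≥ 1` allows `v` to be replaced
by `s v`. -/
theorem exists_increment_bound : ∃ C : ℝ, 0 < C ∧ ∀ N s t, 1 ≤ s → s * mesh N ≤ 1 →
    t ∈ Icc (-T) T → ∀ w w' : ℕ → ℝ, w 0 = 0 → w (N + 1) = 0 → w' 0 = 0 → w' (N + 1) = 0 →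
    ∑ j ∈ Finset.range (N + 1), (W.conjt N s t w w' (j + 1) - W.conjt N s t w w' j) ^ 2 ≤
      C * ∑ j ∈ Finset.range (N + 1),
        (Real.exp (s * W.φ t (node N j)) * (w' (j + 1) - w' j)) ^ 2
      + C * (s * mesh N) ^ 2 * totalEnergy N s (W.conj N s t w) (W.conjt N s t w w') := by
  obtain ⟨C, hC, hB⟩ := W.exists_edge_bounds
  refine ⟨10 * C ^ 4, by positivity, fun N s t hs1 hsh ht w w' hw0 hw1 hw0' hw1' => ?_⟩
  have hh := mesh_pos N
  have hs : 0 < s := by linarith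
  have hC1 : 1 ≤ C ^ 2 := one_le_pow₀ hC
  have hC2 : C ^ 2 ≤ C ^ 4 := pow_le_pow_right₀ hC (by norm_num)
  set v := W.conj N s t w with hv
  set u := W.conjt N s t w w' with hu
  have hv0 : v 0 ^ 2 = 0 := by simp [hv, conj, hw0]
  have hv1 : v (N + 1) ^ 2 = 0 := by simp [hv, conj, hw1]
  have hu1 : u (N + 1) ^ 2 = 0 := by simp [hu, conjt, hw1, hw1']
  have key : ∀ j ∈ Finset.range (N + 1), (u (j + 1) - u j) ^ 2 ≤
      5 * C ^ 4 * (Real.exp (s * W.φ t (node N j)) * (w' (j + 1) - w' j)) ^ 2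
      + 5 * C ^ 4 * (s * mesh N) ^ 2 * (u (j + 1) ^ 2 + s ^ 2 * v (j + 1) ^ 2
        + ((v (j + 1) - v j) * (mesh N)⁻¹) ^ 2 + s ^ 2 * v j ^ 2) := by
    intro j hj
    rw [Finset.mem_range] at hj
    have hB := hB (mesh N) s t (node N j) hh hs hsh ht (node_nonneg _ _)
      (by rw [← node_succ]; exact node_le_one (by omega))
    rw [← node_succ] at hB
    obtain ⟨-, b2, -, -, b5, b6⟩ := hB
    have b6 := (b6 (node N (j + 1)) ⟨node_nonneg _ _, node_le_one (by omega)⟩).1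
    have eρ := W.exp_node_eq N s t j (j + 1)
    set a := Real.exp (s * (W.φ t (node N j) - W.φ t (node N (j + 1))))
    set p := W.φt t (node N j)
    set p' := W.φt t (node N (j + 1))
    have e : u (j + 1) - u j = Real.exp (s * W.φ t (node N j)) * (w' (j + 1) - w' j)
        + (1 - a) * u (j + 1) + ((a - 1) * p') * (s * v (j + 1))
        + (s * mesh N * p') * ((v (j + 1) - v j) * (mesh N)⁻¹) + (s * (p' - p)) * v j := by
      have e1 : s * mesh N * p' * ((v (j + 1) - v j) * (mesh N)⁻¹) = s * p' * (v (j + 1) - v j) := by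
        field_simp
      have e2 : u (j + 1) = Real.exp (s * W.φ t (node N (j + 1))) * w' (j + 1)
          + s * p' * v (j + 1) := by simp only [hu, hv, conjt, conj]; ring
      have e3 : u j = Real.exp (s * W.φ t (node N j)) * w' j
          + s * p * v j := by simp only [hu, hv, conjt, conj]; ring
      rw [e1]
      linear_combination a * e2 - e3 - w' (j + 1) * eρ
    have c1 : |1 - a| ≤ C * (s * mesh N) := by rw [abs_sub_comm]; exact b2
    have c2 : |(a - 1) * p'| ≤ C * (s * mesh N) * C := by
      rw [abs_mul]
      exact mul_le_mul b2 b6 (abs_nonneg _) (by positivity)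
    have c3 : |s * mesh N * p'| ≤ s * mesh N * C := by
      rw [abs_mul, abs_of_pos (by positivity)]
      exact mul_le_mul_of_nonneg_left b6 (by positivity)
    have c4 : |s * (p' - p)| ≤ s * (C * mesh N) := by
      rw [abs_mul, abs_of_pos hs]
      exact mul_le_mul_of_nonneg_left b5 hs.le
    have d1 := sq_mul_le_of_abs_le (x := u (j + 1)) c1
    have d2 := sq_mul_le_of_abs_le (x := s * v (j + 1)) c2
    have d3 := sq_mul_le_of_abs_le (x := (v (j + 1) - v j) * (mesh N)⁻¹) c3
    have d4 := sq_mul_le_of_abs_le (x := v j) c4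
    rw [e]
    refine (sq_add_five_le _ _ _ _ _).trans ?_
    have hτ2 : 0 ≤ (s * mesh N) ^ 2 := sq_nonneg _
    have f1 : (C * (s * mesh N)) ^ 2 * u (j + 1) ^ 2 ≤ C ^ 4 * ((s * mesh N) ^ 2 * u (j + 1) ^ 2) := by
      rw [mul_pow, mul_assoc]; gcongr
    have f2 : (C * (s * mesh N) * C) ^ 2 * (s * v (j + 1)) ^ 2
        = C ^ 4 * ((s * mesh N) ^ 2 * (s ^ 2 * v (j + 1) ^ 2)) := by ring
    have f3 : (s * mesh N * C) ^ 2 * ((v (j + 1) - v j) * (mesh N)⁻¹) ^ 2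
        ≤ C ^ 4 * ((s * mesh N) ^ 2 * ((v (j + 1) - v j) * (mesh N)⁻¹) ^ 2) := by
      rw [mul_comm _ C, mul_pow, mul_assoc]; gcongr
    have f4 : (s * (C * mesh N)) ^ 2 * v j ^ 2 ≤ C ^ 4 * ((s * mesh N) ^ 2 * (s ^ 2 * v j ^ 2)) := by
      calc _ = C ^ 2 * ((s * mesh N) ^ 2 * (1 * v j ^ 2)) := by ring
        _ ≤ _ := by
          have : 1 ≤ s ^ 2 := one_le_pow₀ hs1
          gcongr
    have f0 : (Real.exp (s * W.φ t (node N j)) * (w' (j + 1) - w' j)) ^ 2 ≤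
        C ^ 4 * (Real.exp (s * W.φ t (node N j)) * (w' (j + 1) - w' j)) ^ 2 :=
      le_mul_of_one_le_left (sq_nonneg _) (hC1.trans hC2)
    linarith
  refine (Finset.sum_le_sum key).trans ?_
  rw [Finset.sum_add_distrib, ← Finset.mul_sum, ← Finset.mul_sum, Finset.sum_add_distrib,
    Finset.sum_add_distrib, Finset.sum_add_distrib, ← Finset.mul_sum, ← Finset.mul_sum,
    sum_range_eq_sum_Icc (f := fun j => v j ^ 2) hv0,
    sum_range_succ_eq_sum_Icc (f := fun j => v j ^ 2) hv1,
    sum_range_succ_eq_sum_Icc (f := fun j => u j ^ 2) hu1, totalEnergy]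
  have S1 : 0 ≤ ∑ j ∈ Finset.Icc 1 N, u j ^ 2 := Finset.sum_nonneg fun _ _ => sq_nonneg _
  have S2 : 0 ≤ ∑ j ∈ Finset.range (N + 1), ((v (j + 1) - v j) * (mesh N)⁻¹) ^ 2 :=
    Finset.sum_nonneg fun _ _ => sq_nonneg _
  have S3 : 0 ≤ ∑ j ∈ Finset.range (N + 1),
      (Real.exp (s * W.φ t (node N j)) * (w' (j + 1) - w' j)) ^ 2 :=
    Finset.sum_nonneg fun _ _ => sq_nonneg _
  have S4 : 0 ≤ C ^ 4 * (s * mesh N) ^ 2 := by positivity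
  have S5 : 0 ≤ C ^ 4 := by positivity
  have := mul_nonneg S4 S1
  have := mul_nonneg S4 S2
  have := mul_nonneg S5 S3
  linarith

/-- Undoing the conjugation: `e^{sφ} w' = u - s φ_t v`, and `e^{sφ} ∂_h^+ w` is a bounded multiple
of `∂_h^+ v` plus `O(s) v`. -/
theorem exists_energy_bound : ∃ C : ℝ, 0 < C ∧ ∀ N s t, 1 ≤ s → s * mesh N ≤ 1 →
    t ∈ Icc (-T) T → ∀ w w' : ℕ → ℝ, w 0 = 0 → w (N + 1) = 0 →
    ∑ j ∈ Finset.Icc 1 N, (Real.exp (s * W.φ t (node N j)) * w' j) ^ 2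
      + ∑ j ∈ Finset.range (N + 1), (Real.exp (s * W.φ t (node N j)) * dPlus N w j) ^ 2
      + s ^ 2 * ∑ j ∈ Finset.Icc 1 N, (Real.exp (s * W.φ t (node N j)) * w j) ^ 2
      ≤ C * totalEnergy N s (W.conj N s t w) (W.conjt N s t w w') := by
  obtain ⟨C, hC, hB⟩ := W.exists_edge_bounds
  refine ⟨5 * C ^ 2, by positivity, fun N s t hs1 hsh ht w w' hw0 hw1 => ?_⟩
  have hh := mesh_pos N
  have hs : 0 < s := by linarith
  have hC1 : 1 ≤ C ^ 2 := one_le_pow₀ hC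
  set v := W.conj N s t w with hv
  set u := W.conjt N s t w w' with hu
  have hv0 : v 0 ^ 2 = 0 := by simp [hv, conj, hw0]
  have hedge : ∀ j, j < N + 1 → _ := fun j hj => hB (mesh N) s t (node N j) hh hs hsh ht
    (node_nonneg _ _) (by rw [← node_succ]; exact node_le_one (by omega))
  have k1 : ∀ j ∈ Finset.Icc 1 N, (Real.exp (s * W.φ t (node N j)) * w' j) ^ 2 ≤
      2 * C ^ 2 * (u j ^ 2 + s ^ 2 * v j ^ 2) := by
    intro j hj
    rw [Finset.mem_Icc] at hj
    have b := ((hedge 0 (by omega)).2.2.2.2.2 (node N j)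
      ⟨node_nonneg _ _, node_le_one (by omega)⟩).1
    have e : Real.exp (s * W.φ t (node N j)) * w' j = u j - W.φt t (node N j) * (s * v j) := by
      simp only [hu, hv, conjt, conj]; ring
    have b1 := sq_mul_le_of_abs_le (x := s * v j) b
    have b2 : u j ^ 2 ≤ C ^ 2 * u j ^ 2 := le_mul_of_one_le_left (sq_nonneg _) hC1
    rw [e]
    nlinarith [sq_nonneg (u j + W.φt t (node N j) * (s * v j))]
  have k2 : ∀ j ∈ Finset.range (N + 1), (Real.exp (s * W.φ t (node N j)) * dPlus N w j) ^ 2 ≤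
      2 * C ^ 2 * (((v (j + 1) - v j) * (mesh N)⁻¹) ^ 2 + s ^ 2 * v j ^ 2) := by
    intro j hj
    rw [Finset.mem_range] at hj
    have hB := hedge j hj
    rw [← node_succ] at hB
    obtain ⟨b1, b2, -⟩ := hB
    have eρ := W.exp_node_eq N s t j (j + 1)
    set a := Real.exp (s * (W.φ t (node N j) - W.φ t (node N (j + 1))))
    have e : Real.exp (s * W.φ t (node N j)) * dPlus N w j = a * ((v (j + 1) - v j) * (mesh N)⁻¹)
        + ((a - 1) * (mesh N)⁻¹) * v j := by
      simp only [hv, conj, dPlus, div_eq_mul_inv]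
      linear_combination w (j + 1) * (mesh N)⁻¹ * eρ
    have b3 : |(a - 1) * (mesh N)⁻¹| ≤ C * s := by
      rw [abs_mul, abs_of_pos (inv_pos.2 hh), ← div_eq_mul_inv, div_le_iff₀ hh]
      linarith
    have c1 := sq_mul_le_of_abs_le (x := (v (j + 1) - v j) * (mesh N)⁻¹) b1
    have c2 := sq_mul_le_of_abs_le (x := v j) b3
    rw [e]
    nlinarith [sq_nonneg (a * ((v (j + 1) - v j) * (mesh N)⁻¹) - ((a - 1) * (mesh N)⁻¹) * v j)]
  have k3 : ∀ j ∈ Finset.Icc 1 N, (Real.exp (s * W.φ t (node N j)) * w j) ^ 2 = v j ^ 2 :=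
    fun j _ => rfl
  have K1 := Finset.sum_le_sum k1
  have K2 := Finset.sum_le_sum k2
  rw [Finset.sum_congr rfl k3]
  rw [← Finset.mul_sum, Finset.sum_add_distrib, ← Finset.mul_sum] at K1 K2
  rw [sum_range_eq_sum_Icc (f := fun j => v j ^ 2) hv0] at K2
  have S1 : 0 ≤ ∑ j ∈ Finset.Icc 1 N, u j ^ 2 := Finset.sum_nonneg fun _ _ => sq_nonneg _
  have S2 : 0 ≤ ∑ j ∈ Finset.range (N + 1), ((v (j + 1) - v j) * (mesh N)⁻¹) ^ 2 :=
    Finset.sum_nonneg fun _ _ => sq_nonneg _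
  have S3 : 0 ≤ s ^ 2 * ∑ j ∈ Finset.Icc 1 N, v j ^ 2 :=
    mul_nonneg (sq_nonneg _) (Finset.sum_nonneg fun _ _ => sq_nonneg _)
  have S4 : 0 ≤ C ^ 2 := by positivity
  have := mul_nonneg S4 S1
  have := mul_nonneg S4 S2
  have := le_mul_of_one_le_left S3 hC1
  rw [totalEnergy]
  linarith

/-- As `w` vanishes at the last node, the quotient `v_N / h` is the weighted normal difference up to
sign and a bounded ratio of weights. -/
theorem exists_boundary_bound : ∃ C : ℝ, 0 < C ∧ ∀ N s t, 0 < s → s * mesh N ≤ 1 →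
    t ∈ Icc (-T) T → ∀ w : ℕ → ℝ, w (N + 1) = 0 →
    W.c (s * mesh N) t (node N (N + 1)) * W.m (s * mesh N) t (node N (N + 1))
        * (W.conj N s t w N * (mesh N)⁻¹) ^ 2
      ≤ C * (Real.exp (s * W.φ t 1) * dMinus N w (N + 1)) ^ 2 := by
  obtain ⟨C, hC, hB⟩ := W.exists_edge_bounds
  refine ⟨C ^ 3, by positivity, fun N s t hs hsh ht w hw1 => ?_⟩
  obtain ⟨b1, -, -, -, -, b6⟩ := hB (mesh N) s t (node N N) (mesh_pos N) hs hsh ht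
    (node_nonneg _ _) (by rw [← node_succ]; exact node_le_one le_rfl)
  have b7 := (b6 (node N (N + 1)) ⟨node_nonneg _ _, node_le_one le_rfl⟩).2.2
  rw [← node_succ] at b1
  have eρ := W.exp_node_eq N s t N (N + 1)
  have e : W.conj N s t w N * (mesh N)⁻¹ =
      Real.exp (s * (W.φ t (node N N) - W.φ t (node N (N + 1))))
        * -(Real.exp (s * W.φ t 1) * dMinus N w (N + 1)) := by
    rw [conj, eρ, node_last, dMinus, hw1, Nat.add_sub_cancel, div_eq_mul_inv]; ring
  have h1 := sq_mul_le_of_abs_le (x := -(Real.exp (s * W.φ t 1) * dMinus N w (N + 1))) b1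
  rw [e]
  calc _ ≤ C * (C ^ 2 * (-(Real.exp (s * W.φ t 1) * dMinus N w (N + 1))) ^ 2) :=
        mul_le_mul ((le_abs_self _).trans b7) h1 (sq_nonneg _) (by positivity)
    _ = _ := by ring

end CarlemanWeight

/-! ### The estimate at a fixed time -/

lemma exp_two_mul_mul_sq_abs (s a x : ℝ) :
    Real.exp (2 * s * a) * |x| ^ 2 = (Real.exp (s * a) * x) ^ 2 := by
  rw [sq_abs, mul_pow, ← Real.exp_nat_mul]
  congr 2; push_cast; ring

lemma totalEnergy_nonneg (N : ℕ) (s : ℝ) (v u : ℕ → ℝ) : 0 ≤ totalEnergy N s v u := by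
  unfold totalEnergy; positivity

lemma sq_mul_sum_le_totalEnergy (N : ℕ) (s : ℝ) (v u : ℕ → ℝ) :
    s ^ 2 * ∑ j ∈ Finset.Icc 1 N, v j ^ 2 ≤ totalEnergy N s v u := by
  have h1 : 0 ≤ ∑ j ∈ Finset.Icc 1 N, u j ^ 2 := by positivity
  have h2 : 0 ≤ ∑ j ∈ Finset.range (N + 1), ((v (j + 1) - v j) * (mesh N)⁻¹) ^ 2 := by positivity
  unfold totalEnergy; linarith

lemma sum_edges_eq_totalEnergy {N : ℕ} (s : ℝ) {v u : ℕ → ℝ} (hv0 : v 0 = 0) (hv1 : v (N + 1) = 0)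
    (hu0 : u 0 = 0) (hu1 : u (N + 1) = 0) :
    ∑ j ∈ Finset.range (N + 1), ((u j ^ 2 + u (j + 1) ^ 2) / 2
      + s ^ 2 * ((v j ^ 2 + v (j + 1) ^ 2) / 2) + ((v (j + 1) - v j) * (mesh N)⁻¹) ^ 2)
      = totalEnergy N s v u := by
  rw [Finset.sum_add_distrib, Finset.sum_add_distrib, ← Finset.mul_sum, totalEnergy,
    sum_nodes_eq_sum_edges_avg (X := fun j => u j ^ 2) (by simp [hu0]) (by simp [hu1]),
    sum_nodes_eq_sum_edges_avg (X := fun j => v j ^ 2) (by simp [hv0]) (by simp [hv1])]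

namespace CarlemanWeight

variable {T : ℝ} (W : CarlemanWeight T)

theorem sum_conjMain_mul_conjMult (N : ℕ) (s t : ℝ) {v u : ℕ → ℝ} (z : ℕ → ℝ)
    (hv0 : v 0 = 0) (hv1 : v (N + 1) = 0) (hu0 : u 0 = 0) (hu1 : u (N + 1) = 0) :
    ∑ j ∈ Finset.Icc 1 N, W.conjMain N s t v z j * W.conjMult N s t v u j =
      W.energyRate N s t v u z
      + ∑ j ∈ Finset.range (N + 1), W.edge (mesh N)⁻¹ s (s * mesh N) t (node N j) (node N (j + 1))
          (u j) (u (j + 1)) (v j) (v (j + 1))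
      + (W.c (s * mesh N) t (node N 0) * W.m (s * mesh N) t (node N 0) * (v 1 * (mesh N)⁻¹) ^ 2
          - W.c (s * mesh N) t (node N (N + 1)) * W.m (s * mesh N) t (node N (N + 1))
            * (v N * (mesh N)⁻¹) ^ 2) * (mesh N)⁻¹ :=
  sum_mul_eq_edgeDensity N (mesh N)⁻¹ s (fun j => W.φt t (node N j)) (fun j => W.φtt t (node N j))
    (fun j => W.m (s * mesh N) t (node N j))
    (fun j => W.c (s * mesh N) t (node N j) * W.φtx t (node N j)) (fun j => W.θ t (node N j))
    (fun j => W.θt t (node N j)) (fun j => W.c (s * mesh N) t (node N j))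
    (fun j => W.Q (s * mesh N) t (node N j)) (fun j => W.cφtt (s * mesh N) t (node N j))
    (fun j => W.Qφtt (s * mesh N) t (node N j)) u v z hv0 hv1 hu0 hu1

/-- The Carleman estimate before integration in time. -/
theorem exists_pointwise_estimate : ∃ M M' σ δ : ℝ, 0 < M ∧ 1 ≤ σ ∧ 0 < δ ∧
    ∀ N, mesh N ≤ δ → ∀ s, σ < s → s * mesh N ≤ δ → ∀ t ∈ Icc (-T) T, ∀ w w' w'' : ℕ → ℝ,
    w 0 = 0 → w (N + 1) = 0 → w' 0 = 0 → w' (N + 1) = 0 →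
    s * intOpen N (fun j => Real.exp (2 * s * W.φ t (node N j)) * |w' j| ^ 2)
      + s * intLeft N (fun j => Real.exp (2 * s * W.φ t (node N j)) * |dPlus N w j| ^ 2)
      + s ^ 3 * intOpen N (fun j => Real.exp (2 * s * W.φ t (node N j)) * |w j| ^ 2)
    ≤ M * intOpen N (fun j => Real.exp (2 * s * W.φ t (node N j)) * |w'' j - lap N w j| ^ 2)
      + M * s * (Real.exp (2 * s * W.φ t 1) * |dMinus N w (N + 1)| ^ 2)
      + M * s * intLeft N (fun j =>
          Real.exp (2 * s * W.φ t (node N j)) * |mesh N * dPlus N w' j| ^ 2)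
      - M' * s * mesh N * W.energyRate N s t (W.conj N s t w) (W.conjt N s t w w')
          (W.conjtt N s t w w' w'') := by
  obtain ⟨C1, σ, hC1, hσ, hedge⟩ := W.exists_edge_lower_bound
  obtain ⟨C2, hC2, hrem⟩ := W.exists_remainder_bound
  obtain ⟨C3, hC3, hinc⟩ := W.exists_increment_bound
  obtain ⟨C4, hC4, hen⟩ := W.exists_energy_bound
  obtain ⟨Cb, hCb, hbd⟩ := W.exists_boundary_bound
  have hκ := W.κ_pos
  -- Makes the part `τ² Y` of the increment bound absorbable, `Y` being the total energy.
  have hsmall : ∀ᶠ δ in nhdsWithin (0 : ℝ) (Ioi 0), 4 * C1 * C3 * δ ^ 2 ≤ W.κ / 2 := by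
    have : Filter.Tendsto (fun δ : ℝ => 4 * C1 * C3 * δ ^ 2) (nhdsWithin (0 : ℝ) (Ioi 0))
        (nhds (4 * C1 * C3 * 0 ^ 2)) :=
      (Continuous.tendsto (by fun_prop) 0).mono_left nhdsWithin_le_nhds
    exact (this.eventually_lt_const (by simpa using hκ)).mono fun _ h => h.le
  have hone : ∀ᶠ δ in nhdsWithin (0 : ℝ) (Ioi 0), δ ∈ Ioo (0 : ℝ) 1 := Ioo_mem_nhdsGT one_pos
  obtain ⟨δ, hedge, hsmall, hδ0, hδ1⟩ := (hedge.and (hsmall.and hone)).exists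
  -- The first constant adds up the factors of the source, increment and boundary terms. The lower
  -- bound on `s` makes `2 C2 Y ≤ κ s Y / 2`, which absorbs the remainder.
  refine ⟨C4 / W.κ * (2 + 4 * C1 * C3 + 4 * Cb), C4 / W.κ * 4, σ + 4 * C2 / W.κ + 1, δ,
    by positivity, by have : 0 < 4 * C2 / W.κ := by positivity
                      linarith, hδ0, ?_⟩
  intro N hN s hs hsh t ht w w' w'' hw0 hw1 hw0' hw1'
  have hh := mesh_pos N
  have hpos : 0 < 4 * C2 / W.κ := by positivity
  have hs1 : 1 ≤ s := by linarith
  have hs0 : 0 < s := by linarith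
  have hsC2 : 4 * C2 ≤ W.κ * s := by
    have : 4 * C2 / W.κ ≤ s := by linarith
    rw [div_le_iff₀ hκ] at this; linarith
  have hsh1 : s * mesh N ≤ 1 := hsh.trans hδ1.le
  simp only [exp_two_mul_mul_sq_abs, intOpen, intLeft]
  have hrem := hrem N s t hs0 hsh1 ht w w' w'' hw0 hw1
  have hinc := hinc N s t hs1 hsh1 ht w w' hw0 hw1 hw0' hw1'
  have hen := hen N s t hs1 hsh1 ht w w' hw0 hw1
  have hbd := hbd N s t hs0 hsh1 ht w hw1
  have hv0 : W.conj N s t w 0 = 0 := by simp [conj, hw0]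
  have hv1 : W.conj N s t w (N + 1) = 0 := by simp [conj, hw1]
  have hu0 : W.conjt N s t w w' 0 = 0 := by simp [conjt, hw0, hw0']
  have hu1 : W.conjt N s t w w' (N + 1) = 0 := by simp [conjt, hw1, hw1']
  generalize W.conj N s t w = v at *
  generalize W.conjt N s t w w' = u at *
  generalize W.conjtt N s t w w' w'' = z at *
  have hid := W.sum_conjMain_mul_conjMult N s t z hv0 hv1 hu0 hu1
  have hY := totalEnergy_nonneg N s v u
  have hVY := sq_mul_sum_le_totalEnergy N s v u
  -- the product of the two parts is bounded by the source and the remainder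
  have hprod : 4 * s * ∑ j ∈ Finset.Icc 1 N, W.conjMain N s t v z j * W.conjMult N s t v u j ≤
      2 * ∑ j ∈ Finset.Icc 1 N,
          (Real.exp (s * W.φ t (node N j)) * (w'' j - lap N w j)) ^ 2
      + 2 * ∑ j ∈ Finset.Icc 1 N, (Real.exp (s * W.φ t (node N j)) * (w'' j - lap N w j)
          - W.conjMain N s t v z j - s * W.conjMult N s t v u j) ^ 2 := by
    rw [Finset.mul_sum, Finset.mul_sum, Finset.mul_sum, ← Finset.sum_add_distrib]
    refine Finset.sum_le_sum fun j _ => ?_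
    generalize Real.exp (s * W.φ t (node N j)) * (w'' j - lap N w j) = f
    generalize W.conjMain N s t v z j = A
    generalize W.conjMult N s t v u j = B
    -- `4sAB = (A + sB)² - (A - sB)²`, and `A + sB` is the source minus the remainder.
    nlinarith [sq_nonneg (A - s * B), sq_nonneg (2 * f - A - s * B)]
  have hsum : W.κ / 2 * totalEnergy N s v u
      - C1 * ∑ j ∈ Finset.range (N + 1), (u (j + 1) - u j) ^ 2 ≤
      ∑ j ∈ Finset.range (N + 1), W.edge (mesh N)⁻¹ s (s * mesh N) t (node N j) (node N (j + 1))
          (u j) (u (j + 1)) (v j) (v (j + 1)) := by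
    rw [← sum_edges_eq_totalEnergy s hv0 hv1 hu0 hu1, Finset.mul_sum, Finset.mul_sum,
      ← Finset.sum_sub_distrib]
    refine Finset.sum_le_sum fun j hj => ?_
    rw [Finset.mem_range] at hj
    have := hedge (mesh N) ⟨hh, hN⟩ s (by linarith) hsh t ht (node N j) (node_nonneg _ _)
      (by rw [← node_succ]; exact node_le_one (by omega)) (u j) (u (j + 1)) (v j) (v (j + 1))
    rwa [← node_succ] at this
  -- Monotonicity of the weight in `x` gives the left boundary term a sign, so no observation is
  -- needed at `x = 0`.
  have hm0 : 0 ≤ W.c (s * mesh N) t (node N 0) * W.m (s * mesh N) t (node N 0) := by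
    have hτ : 0 < s * mesh N := mul_pos hs0 hh
    rw [W.m_eq hτ.ne']
    have h1 := W.φx_nonneg t ht (node N 0) ⟨node_nonneg _ _, node_le_one (by omega)⟩
    have h2 : 0 ≤ Real.sinh (s * mesh N * W.φx t (node N 0)) :=
      Real.sinh_nonneg_iff.2 (by positivity)
    have h3 : 0 < W.c (s * mesh N) t (node N 0) := Real.cosh_pos _
    positivity
  have hb0 : 0 ≤ W.c (s * mesh N) t (node N 0) * W.m (s * mesh N) t (node N 0)
      * (v 1 * (mesh N)⁻¹) ^ 2 := mul_nonneg hm0 (sq_nonneg _)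
  have e1 : ∀ j, Real.exp (s * W.φ t (node N j)) * (mesh N * dPlus N w' j)
      = Real.exp (s * W.φ t (node N j)) * (w' (j + 1) - w' j) := fun j => by
    rw [dPlus, mul_div_cancel₀ _ hh.ne']
  simp only [e1]
  set F := ∑ j ∈ Finset.Icc 1 N, (Real.exp (s * W.φ t (node N j)) * (w'' j - lap N w j)) ^ 2
  set G := ∑ j ∈ Finset.range (N + 1),
    (Real.exp (s * W.φ t (node N j)) * (w' (j + 1) - w' j)) ^ 2
  set B := (Real.exp (s * W.φ t 1) * dMinus N w (N + 1)) ^ 2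
  set Y := totalEnergy N s v u
  have hF0 : 0 ≤ F := Finset.sum_nonneg fun _ _ => sq_nonneg _
  have hG0 : 0 ≤ G := Finset.sum_nonneg fun _ _ => sq_nonneg _
  have hB0 : 0 ≤ B := sq_nonneg _
  have hτY : 4 * C1 * C3 * (s * mesh N) ^ 2 * Y ≤ W.κ / 2 * Y := by
    refine mul_le_mul_of_nonneg_right (le_trans ?_ hsmall) hY
    gcongr
  -- Coercivity provides `2 κ s Y`; the increments and the remainder take `κ s Y / 2` each.
  have hmain : W.κ * (s * Y) ≤ 2 * F + 4 * C1 * C3 * (s * G) + 4 * Cb * (s * B * (mesh N)⁻¹)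
      - 4 * s * W.energyRate N s t v u z := by
    have h1 : 4 * s * (W.energyRate N s t v u z + (W.κ / 2 * Y - C1 * (C3 * G
        + C3 * (s * mesh N) ^ 2 * Y)) - Cb * B * (mesh N)⁻¹) ≤ 2 * F + 2 * (C2 * Y) := by
      refine le_trans ?_ (hprod.trans ?_)
      · refine mul_le_mul_of_nonneg_left ?_ (by positivity)
        rw [hid]
        have h2 := mul_le_mul_of_nonneg_left hinc hC1.le
        have h3 := mul_le_mul_of_nonneg_right (show -(Cb * B) ≤ _ from
          neg_le_neg hbd |>.trans (le_add_of_nonneg_left hb0)) (inv_nonneg.2 hh.le)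
        linarith
      · have := mul_le_mul_of_nonneg_left hVY hC2.le
        linarith
    have h4 := mul_le_mul_of_nonneg_left hτY hs0.le
    have h5 := mul_le_mul_of_nonneg_right hsC2 hY
    linarith
  have hlhs := mul_le_mul_of_nonneg_left hen (mul_nonneg hs0.le hh.le)
  -- Multiplying by `h` restores the discrete integrals and cancels the `h⁻¹` of the boundary term.
  have hcoef : 0 < C4 / W.κ * mesh N := by positivity
  have h6 := mul_le_mul_of_nonneg_left hmain hcoef.le
  have e2 : C4 / W.κ * mesh N * (W.κ * (s * Y)) = s * mesh N * (C4 * Y) := by field_simp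
  have e3 : C4 / W.κ * mesh N * (4 * Cb * (s * B * (mesh N)⁻¹)) = C4 / W.κ * (4 * Cb) * (s * B) := by
    field_simp
  have hc : 0 ≤ C4 / W.κ := by positivity
  have g1 : 0 ≤ C4 / W.κ * (4 * C1 * C3 + 4 * Cb) * (mesh N * F) := by positivity
  have g2 : 0 ≤ C4 / W.κ * (2 + 4 * Cb) * (s * (mesh N * G)) := by positivity
  have g3 : 0 ≤ C4 / W.κ * (2 + 4 * C1 * C3) * (s * B) := by positivity
  rw [e2] at h6
  rw [mul_sub, mul_add, mul_add, e3] at h6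
  linarith

end CarlemanWeight

/-! ### Integration in time -/

lemma absolutelyContinuousOnInterval_of_hasDerivAt {f F : ℝ → ℝ} (hf : ∀ t, HasDerivAt f (F t) t)
    (hF : Continuous F) (a b : ℝ) : AbsolutelyContinuousOnInterval f a b := by
  refine ContDiffOn.absolutelyContinuousOnInterval (ContDiff.contDiffOn ?_)
  rw [contDiff_one_iff_deriv]
  exact ⟨fun t => (hf t).differentiableAt, by rwa [deriv_eq hf]⟩

lemma AbsolutelyContinuousOnInterval.finsetSum {ι : Type*} {a b : ℝ} {f : ι → ℝ → ℝ}
    {S : Finset ι} (hf : ∀ i ∈ S, AbsolutelyContinuousOnInterval (f i) a b) :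
    AbsolutelyContinuousOnInterval (fun t => ∑ i ∈ S, f i t) a b := by
  classical
  induction S using Finset.induction_on with
  | empty =>
    simpa using absolutelyContinuousOnInterval_of_hasDerivAt (fun t => hasDerivAt_const t (0 : ℝ))
      continuous_const a b
  | insert i S hi ih =>
    simp only [Finset.sum_insert hi]
    exact (hf i (Finset.mem_insert_self _ _)).fun_add
      (ih fun j hj => hf j (Finset.mem_insert_of_mem hj))

namespace CarlemanWeight

variable {T : ℝ} (W : CarlemanWeight T)

/-- The energy whose time derivative appears in the product of the two parts of the conjugated
operator. -/
def energy (N : ℕ) (s t : ℝ) (v u : ℕ → ℝ) : ℝ :=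
  ∑ j ∈ Finset.Icc 1 N,
      (2 * (W.m (s * mesh N) t (node N j) * (u j * ((v (j + 1) - v (j - 1)) * ((mesh N)⁻¹ / 2))))
        - W.φt t (node N j) * (u j * u j) - W.θ t (node N j) * (v j * u j)
        - s ^ 2 * (W.Q (s * mesh N) t (node N j) * W.φt t (node N j) * (v j * v j)))
    - ∑ j ∈ Finset.range (N + 1),
        (1 / 2 * (mesh N)⁻¹ ^ 2) * ((W.c (s * mesh N) t (node N j) * W.φt t (node N j)
            + W.c (s * mesh N) t (node N (j + 1)) * W.φt t (node N (j + 1)))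
          * ((v (j + 1) - v j) * (v (j + 1) - v j)))

lemma hasDerivAt_energy {N : ℕ} {s t : ℝ} (hs : 0 < s) {v u z : ℕ → ℝ → ℝ}
    (hv : ∀ j, HasDerivAt (v j) (u j t) t) (hu : ∀ j, HasDerivAt (u j) (z j t) t) :
    HasDerivAt (fun r => W.energy N s r (fun j => v j r) (fun j => u j r))
      (W.energyRate N s t (fun j => v j t) (fun j => u j t) (fun j => z j t)) t := by
  have hτ : s * mesh N ≠ 0 := (mul_pos hs (mesh_pos N)).ne'
  refine (HasDerivAt.fun_sub (HasDerivAt.fun_sum fun j _ => ?_)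
    (HasDerivAt.fun_sum fun j _ => ?_))
  · have h1 := ((W.hasDerivAt_m_time hτ t (node N j)).fun_mul ((hu j).fun_mul
      (((hv (j + 1)).fun_sub (hv (j - 1))).mul_const ((mesh N)⁻¹ / 2)))).const_mul 2
    have h2 := (W.deriv_φtt t (node N j)).fun_mul ((hu j).fun_mul (hu j))
    have h3 := (W.deriv_θt t (node N j)).fun_mul ((hv j).fun_mul (hu j))
    have h4 := (((W.hasDerivAt_Q_time hτ t (node N j)).fun_mul
      (W.deriv_φtt t (node N j))).fun_mul ((hv j).fun_mul (hv j))).const_mul (s ^ 2)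
    refine (((h1.fun_sub h2).fun_sub h3).fun_sub h4).congr_deriv ?_
    unfold Qφtt
    ring
  · have h1 := ((W.hasDerivAt_c_time (s * mesh N) t (node N j)).fun_mul
      (W.deriv_φtt t (node N j))).fun_add
        ((W.hasDerivAt_c_time (s * mesh N) t (node N (j + 1))).fun_mul
          (W.deriv_φtt t (node N (j + 1))))
    have h2 := (hv (j + 1)).fun_sub (hv j)
    refine ((h1.fun_mul (h2.fun_mul h2)).const_mul (1 / 2 * (mesh N)⁻¹ ^ 2)).congr_deriv ?_
    unfold cφtt
    ring

/-- `u` is differentiable only almost everywhere when `w` is merely `H²` in time; absolute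
continuity is what the fundamental theorem of calculus needs. -/
lemma absolutelyContinuous_energy {N : ℕ} {s a b : ℝ} (hs : 0 < s) {v u : ℕ → ℝ → ℝ}
    (hv : ∀ j, AbsolutelyContinuousOnInterval (v j) a b)
    (hu : ∀ j, AbsolutelyContinuousOnInterval (u j) a b) :
    AbsolutelyContinuousOnInterval
      (fun r => W.energy N s r (fun j => v j r) (fun j => u j r)) a b := by
  have hτ : s * mesh N ≠ 0 := (mul_pos hs (mesh_pos N)).ne'
  have am : ∀ j, AbsolutelyContinuousOnInterval (fun t => W.m (s * mesh N) t (node N j)) a b :=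
    fun j => absolutelyContinuousOnInterval_of_hasDerivAt
      (fun t => W.hasDerivAt_m_time hτ t (node N j)) (by fun_prop) a b
  have aQ : ∀ j, AbsolutelyContinuousOnInterval (fun t => W.Q (s * mesh N) t (node N j)) a b :=
    fun j => absolutelyContinuousOnInterval_of_hasDerivAt
      (fun t => W.hasDerivAt_Q_time hτ t (node N j)) (by fun_prop) a b
  have ac : ∀ j, AbsolutelyContinuousOnInterval (fun t => W.c (s * mesh N) t (node N j)) a b :=
    fun j => absolutelyContinuousOnInterval_of_hasDerivAt
      (fun t => W.hasDerivAt_c_time (s * mesh N) t (node N j)) (by fun_prop) a b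
  have ap : ∀ j, AbsolutelyContinuousOnInterval (fun t => W.φt t (node N j)) a b :=
    fun j => absolutelyContinuousOnInterval_of_hasDerivAt
      (fun t => W.deriv_φtt t (node N j)) (by fun_prop) a b
  have aθ : ∀ j, AbsolutelyContinuousOnInterval (fun t => W.θ t (node N j)) a b :=
    fun j => absolutelyContinuousOnInterval_of_hasDerivAt
      (fun t => W.deriv_θt t (node N j)) (by fun_prop) a b
  have ak : ∀ k : ℝ, AbsolutelyContinuousOnInterval (fun _ => k) a b :=
    fun k => absolutelyContinuousOnInterval_of_hasDerivAt
      (fun t => hasDerivAt_const t k) (by fun_prop) a b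
  unfold energy
  refine (AbsolutelyContinuousOnInterval.finsetSum fun j _ => ?_).fun_sub
    (AbsolutelyContinuousOnInterval.finsetSum fun j _ => ?_)
  · exact (((((am j).fun_mul ((hu j).fun_mul (((hv (j + 1)).fun_sub (hv (j - 1))).fun_mul
      (ak _)))).const_mul 2).fun_sub ((ap j).fun_mul ((hu j).fun_mul (hu j)))).fun_sub
      ((aθ j).fun_mul ((hv j).fun_mul (hu j)))).fun_sub
      ((((aQ j).fun_mul (ap j)).fun_mul ((hv j).fun_mul (hv j))).const_mul (s ^ 2))
  · have h := (hv (j + 1)).fun_sub (hv j)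
    exact ((((ac j).fun_mul (ap j)).fun_add ((ac (j + 1)).fun_mul (ap (j + 1)))).fun_mul
      (h.fun_mul h)).const_mul _

lemma hasDerivAt_conj {N : ℕ} {s t : ℝ} {w : ℕ → ℝ → ℝ} {w' : ℕ → ℝ} {j : ℕ}
    (hw : HasDerivAt (w j) (w' j) t) :
    HasDerivAt (fun r => W.conj N s r (fun i => w i r) j)
      (W.conjt N s t (fun i => w i t) w' j) t := by
  refine (((W.deriv_φt t (node N j)).const_mul s).exp.fun_mul hw).congr_deriv ?_
  unfold conjt; ring

lemma hasDerivAt_conjt {N : ℕ} {s t : ℝ} {w w' : ℕ → ℝ → ℝ} {w'' : ℕ → ℝ} {j : ℕ}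
    (hw : HasDerivAt (w j) (w' j t) t) (hw' : HasDerivAt (w' j) (w'' j) t) :
    HasDerivAt (fun r => W.conjt N s r (fun i => w i r) (fun i => w' i r) j)
      (W.conjtt N s t (fun i => w i t) (fun i => w' i t) w'' j) t := by
  refine (((W.deriv_φt t (node N j)).const_mul s).exp.fun_mul
    (hw'.fun_add (((W.deriv_φtt t (node N j)).const_mul s).fun_mul hw))).congr_deriv ?_
  unfold conjtt; ring

lemma absolutelyContinuous_exp (s x a b : ℝ) :
    AbsolutelyContinuousOnInterval (fun t => Real.exp (s * W.φ t x)) a b :=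
  absolutelyContinuousOnInterval_of_hasDerivAt
    (fun t => ((W.deriv_φt t x).const_mul s).exp) (by fun_prop) a b

/-- The total variation of the energy vanishes for functions with vanishing Cauchy data at both
ends of the time interval. -/
theorem integral_energyRate {N : ℕ} {s : ℝ} (hT : 0 < T) (hs : 0 < s) {w w' w'' : ℕ → ℝ → ℝ}
    (hw : ∀ j, AbsolutelyContinuousOnInterval (w j) (-T) T)
    (hw' : ∀ j, AbsolutelyContinuousOnInterval (w' j) (-T) T)
    (hd : ∀ᵐ t, t ∈ Ioo (-T) T →
      ∀ j, HasDerivAt (w j) (w' j t) t ∧ HasDerivAt (w' j) (w'' j t) t)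
    (hfin : ∀ j, w j T = 0 ∧ w' j T = 0) (hini : ∀ j, w j (-T) = 0 ∧ w' j (-T) = 0) :
    IntervalIntegrable (fun t => W.energyRate N s t (W.conj N s t fun i => w i t)
        (W.conjt N s t (fun i => w i t) fun i => w' i t)
        (W.conjtt N s t (fun i => w i t) (fun i => w' i t) fun i => w'' i t)) volume (-T) T ∧
      ∫ t in (-T)..T, W.energyRate N s t (W.conj N s t fun i => w i t)
        (W.conjt N s t (fun i => w i t) fun i => w' i t)
        (W.conjtt N s t (fun i => w i t) (fun i => w' i t) fun i => w'' i t) = 0 := by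
  have hac := W.absolutelyContinuous_energy (N := N) hs (a := -T) (b := T)
    (v := fun j t => W.conj N s t (fun i => w i t) j)
    (u := fun j t => W.conjt N s t (fun i => w i t) (fun i => w' i t) j)
    (fun j => (W.absolutelyContinuous_exp s (node N j) _ _).fun_mul (hw j))
    (fun j => (W.absolutelyContinuous_exp s (node N j) _ _).fun_mul ((hw' j).fun_add
      (((absolutelyContinuousOnInterval_of_hasDerivAt
        (fun t => W.deriv_φtt t (node N j)) (by fun_prop) _ _).const_mul s).fun_mul (hw j))))
  have hne : ∀ᵐ t : ℝ, t ≠ T := by simp [ae_iff, measure_singleton]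
  have hderiv : ∀ᵐ t, t ∈ uIoc (-T) T → deriv (fun r => W.energy N s r
      (fun j => W.conj N s r (fun i => w i r) j)
      (fun j => W.conjt N s r (fun i => w i r) (fun i => w' i r) j)) t =
      W.energyRate N s t (W.conj N s t fun i => w i t)
        (W.conjt N s t (fun i => w i t) fun i => w' i t)
        (W.conjtt N s t (fun i => w i t) (fun i => w' i t) fun i => w'' i t) := by
    filter_upwards [hd, hne] with t ht htT htm
    rw [uIoc_of_le (by linarith)] at htm
    have ht := ht ⟨htm.1, lt_of_le_of_ne htm.2 htT⟩
    exact (W.hasDerivAt_energy hs (v := fun j t => W.conj N s t (fun i => w i t) j)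
      (u := fun j t => W.conjt N s t (fun i => w i t) (fun i => w' i t) j)
      (z := fun j t => W.conjtt N s t (fun i => w i t) (fun i => w' i t) (fun i => w'' i t) j)
      (fun j => W.hasDerivAt_conj (w' := fun i => w' i t) (ht j).1)
      (fun j => W.hasDerivAt_conjt (w'' := fun i => w'' i t) (ht j).1 (ht j).2)).deriv
  have hint := hac.intervalIntegrable_deriv
  have hval := hac.integral_deriv_eq_sub
  constructor
  · exact hint.congr_ae ((ae_restrict_iff' measurableSet_uIoc).2 hderiv)
  · rw [← intervalIntegral.integral_congr_ae hderiv, hval]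
    simp [energy, conj, conjt, hfin, hini]

/-- The energy rate has integral zero, so the constant in front of it plays no role. The vanishing
conditions are imposed at every index or every time; the extension by zero supplies them. -/
theorem exists_integrated_estimate (hT : 0 < T) : ∃ M σ δ : ℝ, 0 < M ∧ 1 ≤ σ ∧ 0 < δ ∧
    ∀ N, mesh N ≤ δ → ∀ s, σ < s → s * mesh N ≤ δ → ∀ w w' w'' : ℕ → ℝ → ℝ,
    (∀ j, AbsolutelyContinuousOnInterval (w j) (-T) T) →
    (∀ j, AbsolutelyContinuousOnInterval (w' j) (-T) T) →
    (∀ᵐ t, t ∈ Ioo (-T) T →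
      ∀ j, HasDerivAt (w j) (w' j t) t ∧ HasDerivAt (w' j) (w'' j t) t) →
    (∀ j, w j T = 0 ∧ w' j T = 0) → (∀ j, w j (-T) = 0 ∧ w' j (-T) = 0) →
    (∀ t, w 0 t = 0 ∧ w (N + 1) t = 0 ∧ w' 0 t = 0 ∧ w' (N + 1) t = 0) →
    (∀ j ∈ Finset.Icc 1 N,
      MemLp (fun t => w'' j t - lap N (fun i => w i t) j) 2 (volume.restrict (Ioo (-T) T))) →
    s * (∫ t in (-T)..T, intOpen N fun j =>
        Real.exp (2 * s * W.φ t (node N j)) * |w' j t| ^ 2)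
      + s * (∫ t in (-T)..T, intLeft N fun j =>
        Real.exp (2 * s * W.φ t (node N j)) * |dPlus N (fun i => w i t) j| ^ 2)
      + s ^ 3 * (∫ t in (-T)..T, intOpen N fun j =>
        Real.exp (2 * s * W.φ t (node N j)) * |w j t| ^ 2)
    ≤ M * (∫ t in (-T)..T, intOpen N fun j =>
        Real.exp (2 * s * W.φ t (node N j)) * |w'' j t - lap N (fun i => w i t) j| ^ 2)
      + M * s * (∫ t in (-T)..T,
        Real.exp (2 * s * W.φ t 1) * |dMinus N (fun i => w i t) (N + 1)| ^ 2)
      + M * s * (∫ t in (-T)..T, intLeft N fun j =>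
        Real.exp (2 * s * W.φ t (node N j)) * |mesh N * dPlus N (fun i => w' i t) j| ^ 2) := by
  obtain ⟨M, M', σ, δ, hM, hσ, hδ, hpt⟩ := W.exists_pointwise_estimate
  refine ⟨M, σ, δ, hM, hσ, hδ, ?_⟩
  intro N hN s hs hsh w w' w'' hw hw' hd hfin hini hbd hL2
  have hs0 : 0 < s := by linarith
  have hTT : -T ≤ T := by linarith
  obtain ⟨irate, rate0⟩ := W.integral_energyRate (N := N) hT hs0 hw hw' hd hfin hini
  have cw : ∀ j, ContinuousOn (w j) (uIcc (-T) T) := fun j => (hw j).continuousOn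
  have cw' : ∀ j, ContinuousOn (w' j) (uIcc (-T) T) := fun j => (hw' j).continuousOn
  have ce : ∀ x, ContinuousOn (fun t => Real.exp (2 * s * W.φ t x)) (uIcc (-T) T) :=
    fun x => Continuous.continuousOn (by fun_prop)
  have i1 : IntervalIntegrable (fun t => intOpen N fun j =>
      Real.exp (2 * s * W.φ t (node N j)) * |w' j t| ^ 2) volume (-T) T :=
    ContinuousOn.intervalIntegrable (continuousOn_const.mul
      (continuousOn_finsetSum _ fun j _ => (ce _).mul ((cw' j).abs.pow 2)))
  have i2 : IntervalIntegrable (fun t => intLeft N fun j =>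
      Real.exp (2 * s * W.φ t (node N j)) * |dPlus N (fun i => w i t) j| ^ 2) volume (-T) T :=
    ContinuousOn.intervalIntegrable (continuousOn_const.mul
      (continuousOn_finsetSum _ fun j _ => (ce _).mul
        ((((cw (j + 1)).sub (cw j)).div_const _).abs.pow 2)))
  have i3 : IntervalIntegrable (fun t => intOpen N fun j =>
      Real.exp (2 * s * W.φ t (node N j)) * |w j t| ^ 2) volume (-T) T :=
    ContinuousOn.intervalIntegrable (continuousOn_const.mul
      (continuousOn_finsetSum _ fun j _ => (ce _).mul ((cw j).abs.pow 2)))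
  -- Apart from the energy rate, this is the only integrand not known to be continuous; the square
  -- integrability of the source enters here.
  have i4 : IntervalIntegrable (fun t => intOpen N fun j =>
      Real.exp (2 * s * W.φ t (node N j)) * |w'' j t - lap N (fun i => w i t) j| ^ 2)
      volume (-T) T := by
    unfold intOpen
    refine IntervalIntegrable.const_mul ?_ _
    have : ∀ j ∈ Finset.Icc 1 N, IntervalIntegrable (fun t =>
        Real.exp (2 * s * W.φ t (node N j)) * |w'' j t - lap N (fun i => w i t) j| ^ 2)
        volume (-T) T := by
      intro j hj
      refine IntervalIntegrable.continuousOn_mul ?_ (ce _)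
      rw [intervalIntegrable_iff_integrableOn_Ioo_of_le hTT]
      simp only [sq_abs]
      exact (hL2 j hj).integrable_sq
    have := IntervalIntegrable.sum _ this
    simpa only [Finset.sum_fn] using this
  have i5 : IntervalIntegrable (fun t =>
      Real.exp (2 * s * W.φ t 1) * |dMinus N (fun i => w i t) (N + 1)| ^ 2) volume (-T) T :=
    ContinuousOn.intervalIntegrable ((ce _).mul
      ((((cw (N + 1)).sub (cw (N + 1 - 1))).div_const _).abs.pow 2))
  have i6 : IntervalIntegrable (fun t => intLeft N fun j =>
      Real.exp (2 * s * W.φ t (node N j)) * |mesh N * dPlus N (fun i => w' i t) j| ^ 2)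
      volume (-T) T :=
    ContinuousOn.intervalIntegrable (continuousOn_const.mul
      (continuousOn_finsetSum _ fun j _ => (ce _).mul
        ((continuousOn_const.mul (((cw' (j + 1)).sub (cw' j)).div_const _)).abs.pow 2)))
  have hmono := intervalIntegral.integral_mono_on hTT
    (((i1.const_mul s).add (i2.const_mul s)).add (i3.const_mul (s ^ 3)))
    ((((i4.const_mul M).add (i5.const_mul (M * s))).add (i6.const_mul (M * s))).sub
      (irate.const_mul (M' * s * mesh N)))
    (fun t ht => hpt N hN s hs hsh t ht (fun i => w i t) (fun i => w' i t) (fun i => w'' i t)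
      (hbd t).1 (hbd t).2.1 (hbd t).2.2.1 (hbd t).2.2.2)
  rw [intervalIntegral.integral_sub
      (((i4.const_mul M).add (i5.const_mul (M * s))).add (i6.const_mul (M * s)))
      (irate.const_mul (M' * s * mesh N)),
    intervalIntegral.integral_add ((i4.const_mul M).add (i5.const_mul (M * s)))
      (i6.const_mul (M * s)),
    intervalIntegral.integral_add (i4.const_mul M) (i5.const_mul (M * s)),
    intervalIntegral.integral_add ((i1.const_mul s).add (i2.const_mul s)) (i3.const_mul (s ^ 3)),
    intervalIntegral.integral_add (i1.const_mul s) (i2.const_mul s)] at hmono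
  simp only [intervalIntegral.integral_const_mul, rate0, mul_zero, sub_zero] at hmono
  exact hmono

end CarlemanWeight

/-! ### The weight `e^{λψ}` -/

lemma hasDerivAt_phi_time (x0 β C0 lam t x : ℝ) :
    HasDerivAt (fun r => phi x0 β C0 lam r x) (-2 * β * lam * t * phi x0 β C0 lam t x) t := by
  have h : HasDerivAt (fun r => psi x0 β C0 r x) (-(β * (2 * t))) t := by
    have := (((hasDerivAt_pow 2 t).const_mul β).const_sub (|x - x0| ^ 2)).add_const C0
    simpa [psi] using this
  refine (h.const_mul lam).exp.congr_deriv ?_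
  unfold phi; ring

lemma hasDerivAt_phi_space (x0 β C0 lam t x : ℝ) :
    HasDerivAt (fun y => phi x0 β C0 lam t y) (2 * lam * (x - x0) * phi x0 β C0 lam t x) x := by
  have h : HasDerivAt (fun y => psi x0 β C0 t y) (2 * (x - x0)) x := by
    unfold psi
    simp only [sq_abs]
    have := ((((hasDerivAt_id x).sub_const x0).fun_pow 2).sub_const (β * t ^ 2)).add_const C0
    simpa using this
  refine (h.const_mul lam).exp.congr_deriv ?_
  unfold phi; ring

lemma continuous_phi (x0 β C0 lam : ℝ) :
    Continuous fun q : ℝ × ℝ => phi x0 β C0 lam q.1 q.2 := by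
  unfold phi psi; fun_prop

/-- The weight `exp (λ ψ)`, for `λ` large, satisfies the pseudoconvexity conditions. -/
def expWeight (T β x0 C0 : ℝ) (hβ : 0 < β ∧ β < 1) (hx0 : x0 < 0)
    (hψ : ∀ t ∈ Icc (-T) T, ∀ x ∈ Icc (0 : ℝ) 1, 1 ≤ psi x0 β C0 t x) (lam : ℝ) (hlam0 : 0 < lam)
    (hlam : lam * ((1 - β) * x0 ^ 2) = 1) : CarlemanWeight T where
  φ := phi x0 β C0 lam
  φt t x := -2 * β * lam * t * phi x0 β C0 lam t x
  φx t x := 2 * lam * (x - x0) * phi x0 β C0 lam t x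
  φtt t x := (-2 * β * lam + 4 * β ^ 2 * lam ^ 2 * t ^ 2) * phi x0 β C0 lam t x
  φtx t x := -4 * β * lam ^ 2 * t * (x - x0) * phi x0 β C0 lam t x
  φxx t x := (2 * lam + 4 * lam ^ 2 * (x - x0) ^ 2) * phi x0 β C0 lam t x
  -- This is `λ² (ψ_t² - ψ_x²) φ`. It completes the `λ²` part of the quadratic form in `(a, b)` to a
  -- perfect square and leaves `2λ(1 - β)(a² + b²)φ`.
  θ t x := lam ^ 2 * (4 * β ^ 2 * t ^ 2 - 4 * (x - x0) ^ 2) * phi x0 β C0 lam t x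
  θt t x := (lam ^ 2 * (8 * β ^ 2 * t)
    + lam ^ 2 * (4 * β ^ 2 * t ^ 2 - 4 * (x - x0) ^ 2) * (-2 * β * lam * t)) * phi x0 β C0 lam t x
  θx t x := (lam ^ 2 * (-8 * (x - x0))
    + lam ^ 2 * (4 * β ^ 2 * t ^ 2 - 4 * (x - x0) ^ 2) * (2 * lam * (x - x0)))
      * phi x0 β C0 lam t x
  κ := min (2 * lam * (1 - β)) (8 * lam ^ 3 * ((1 - β) * x0 ^ 2))
  cont_φ := continuous_phi ..
  cont_φt := Continuous.mul (by fun_prop) (continuous_phi ..)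
  cont_φx := Continuous.mul (by fun_prop) (continuous_phi ..)
  cont_φtt := Continuous.mul (by fun_prop) (continuous_phi ..)
  cont_φtx := Continuous.mul (by fun_prop) (continuous_phi ..)
  cont_φxx := Continuous.mul (by fun_prop) (continuous_phi ..)
  cont_θ := Continuous.mul (by fun_prop) (continuous_phi ..)
  cont_θt := Continuous.mul (by fun_prop) (continuous_phi ..)
  cont_θx := Continuous.mul (by fun_prop) (continuous_phi ..)
  deriv_φt t x := hasDerivAt_phi_time ..
  deriv_φx t x := hasDerivAt_phi_space ..
  deriv_φtt t x := by
    refine (((hasDerivAt_id t).const_mul (-2 * β * lam)).fun_mul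
      (hasDerivAt_phi_time x0 β C0 lam t x)).congr_deriv ?_
    simp only [id]; ring
  deriv_φtx t x := by
    refine ((hasDerivAt_phi_time x0 β C0 lam t x).const_mul (2 * lam * (x - x0))).congr_deriv ?_
    ring
  deriv_φxt t x := by
    refine ((hasDerivAt_phi_space x0 β C0 lam t x).const_mul (-2 * β * lam * t)).congr_deriv ?_
    ring
  deriv_φxx t x := by
    refine ((((hasDerivAt_id x).sub_const x0).const_mul (2 * lam)).fun_mul
      (hasDerivAt_phi_space x0 β C0 lam t x)).congr_deriv ?_
    simp only [id]; ring
  deriv_θt t x := by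
    refine (((((hasDerivAt_pow 2 t).const_mul (4 * β ^ 2)).sub_const
      (4 * (x - x0) ^ 2)).const_mul (lam ^ 2)).fun_mul
      (hasDerivAt_phi_time x0 β C0 lam t x)).congr_deriv ?_
    push_cast; ring
  deriv_θx t x := by
    refine ((((((hasDerivAt_id x).sub_const x0).fun_pow 2).const_mul 4).const_sub
      (4 * β ^ 2 * t ^ 2)).const_mul (lam ^ 2)).fun_mul
      (hasDerivAt_phi_space x0 β C0 lam t x) |>.congr_deriv ?_
    simp only [id]; push_cast; ring
  κ_pos := by
    have : 0 < 1 - β := by linarith [hβ.2]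
    have : 0 < x0 ^ 2 := sq_pos_iff.2 hx0.ne
    exact lt_min (by positivity) (by positivity)
  φx_nonneg t ht x hx := by
    have : 0 < phi x0 β C0 lam t x := Real.exp_pos _
    have : 0 ≤ x - x0 := by linarith [hx.1]
    positivity
  pseudoconvex t ht x hx a b := by
    have hφ : 1 ≤ phi x0 β C0 lam t x :=
      Real.one_le_exp (mul_nonneg hlam0.le (by linarith [hψ t ht x hx]))
    have hβ' : 0 < 1 - β := by linarith [hβ.2]
    generalize phi x0 β C0 lam t x = φ at *
    have h1 : min (2 * lam * (1 - β)) (8 * lam ^ 3 * ((1 - β) * x0 ^ 2)) * (a ^ 2 + b ^ 2) ≤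
        2 * lam * (1 - β) * (a ^ 2 + b ^ 2) :=
      mul_le_mul_of_nonneg_right (min_le_left _ _) (by positivity)
    have h2 : 2 * lam * (1 - β) * (a ^ 2 + b ^ 2) ≤ 2 * lam * (1 - β) * (a ^ 2 + b ^ 2) * φ :=
      le_mul_of_one_le_right (by positivity) hφ
    -- The perfect square `2λ²(ψ_t a - ψ_x b)² φ`.
    have h3 : 0 ≤ 8 * lam ^ 2 * (β * t * a + (x - x0) * b) ^ 2 * φ := by positivity
    linarith
  pseudoconvex_zero t ht x hx := by
    have hφ : 1 ≤ phi x0 β C0 lam t x :=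
      Real.one_le_exp (mul_nonneg hlam0.le (by linarith [hψ t ht x hx]))
    have hβ' : 0 < 1 - β := by linarith [hβ.2]
    generalize phi x0 β C0 lam t x = φ at *
    -- `D = ψ_t² - ψ_x²`. The zeroth order expression is `λ³φ³` times a quadratic polynomial in `D`.
    obtain ⟨D, hD⟩ : ∃ D, D = 4 * β ^ 2 * t ^ 2 - 4 * (x - x0) ^ 2 := ⟨_, rfl⟩
    have hy : x0 ^ 2 ≤ (x - x0) ^ 2 := by nlinarith [hx.1]
    -- Completing the square in `D` gives the minimum `-(6β + 2)² / (8λ)`. Since `6β + 2 ≤ 8`, it is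
    -- at least `-8/λ`, and the normalisation of `λ` makes this `-8(1 - β) x0²`: half of the
    -- available positive term, as `x - x0 ≥ -x0 > 0`.
    have hquad : -(8 * ((1 - β) * x0 ^ 2)) ≤ 2 * lam * D ^ 2 - (6 * β + 2) * D := by
      have h1 : 0 ≤ (4 * lam * D - (6 * β + 2)) ^ 2 := sq_nonneg _
      have h2 : (6 * β + 2) ^ 2 ≤ 64 := by nlinarith [hβ.1, hβ.2]
      have h3 : 0 ≤ 8 * lam * (2 * lam * D ^ 2 - (6 * β + 2) * D + 8 * ((1 - β) * x0 ^ 2)) := by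
        linear_combination h1 + h2 - 64 * hlam
      linarith [nonneg_of_mul_nonneg_right h3 (by positivity)]
    have hbr : 8 * ((1 - β) * x0 ^ 2) ≤
        16 * ((1 - β) * (x - x0) ^ 2) + 2 * lam * D ^ 2 - (6 * β + 2) * D := by
      have := mul_le_mul_of_nonneg_left hy hβ'.le
      linarith
    have hφ3 : 1 ≤ φ ^ 3 := one_le_pow₀ hφ
    have h0 : 0 ≤ 8 * ((1 - β) * x0 ^ 2) := by positivity
    calc _ ≤ 8 * lam ^ 3 * ((1 - β) * x0 ^ 2) := min_le_right _ _
      _ = lam ^ 3 * (1 * (8 * ((1 - β) * x0 ^ 2))) := by ring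
      _ ≤ lam ^ 3 * (φ ^ 3 * (16 * ((1 - β) * (x - x0) ^ 2) + 2 * lam * D ^ 2
          - (6 * β + 2) * D)) := by gcongr
      _ = _ := by rw [hD]; ring

/-! ### Admissible functions and extension by zero -/

section Extension

variable {T : ℝ} {N : ℕ} {w : ℕ → ℝ → ℝ}

lemma integral_congr_of_Ioo (hT : 0 < T) {f g : ℝ → ℝ} (h : ∀ t ∈ Ioo (-T) T, f t = g t) :
    ∫ t in (-T)..T, f t = ∫ t in (-T)..T, g t := by
  have hne : ∀ᵐ t : ℝ, t ≠ T := by simp [ae_iff, measure_singleton]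
  refine intervalIntegral.integral_congr_ae ?_
  filter_upwards [hne] with t ht htm
  rw [uIoc_of_le (by linarith)] at htm
  exact h t ⟨htm.1, lt_of_le_of_ne htm.2 ht⟩

/-- The extension of a family by zero outside of the interior nodes. -/
def extendZero (N : ℕ) (f : ℕ → ℝ → ℝ) (j : ℕ) : ℝ → ℝ :=
  if j ∈ Finset.Icc 1 N then f j else fun _ => 0

lemma extendZero_of_mem {f : ℕ → ℝ → ℝ} {j : ℕ} (hj : j ∈ Finset.Icc 1 N) :
    extendZero N f j = f j := if_pos hj

lemma extendZero_of_notMem {f : ℕ → ℝ → ℝ} {j : ℕ} (hj : j ∉ Finset.Icc 1 N) :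
    extendZero N f j = fun _ => 0 := if_neg hj

lemma absolutelyContinuous_extendZero {f : ℕ → ℝ → ℝ} {a b : ℝ}
    (hf : ∀ j ∈ Finset.Icc 1 N, AbsolutelyContinuousOnInterval (f j) a b) (j : ℕ) :
    AbsolutelyContinuousOnInterval (extendZero N f j) a b := by
  by_cases hj : j ∈ Finset.Icc 1 N
  · rw [extendZero_of_mem hj]; exact hf j hj
  · rw [extendZero_of_notMem hj]
    exact absolutelyContinuousOnInterval_of_hasDerivAt (fun t => hasDerivAt_const t (0 : ℝ))
      continuous_const a b

namespace Admissible

/-- The derivative is absolutely continuous, hence bounded, so `w j` is Lipschitz on the convex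
interval. -/
lemma absolutelyContinuous_self (hT : 0 < T) (hw : Admissible T N w) {j : ℕ}
    (hj : j ∈ Finset.Icc 1 N) : AbsolutelyContinuousOnInterval (w j) (-T) T := by
  obtain ⟨C, hC⟩ := (hw.absolutelyContinuous j hj).exists_bound
  rw [uIcc_of_le (by linarith)] at hC
  have hC0 : 0 ≤ C := (norm_nonneg _).trans (hC T ⟨by linarith, le_rfl⟩)
  have : LipschitzOnWith ⟨C, hC0⟩ (w j) (Icc (-T) T) :=
    (convex_Icc (-T) T).lipschitzOnWith_of_nnnorm_derivWithin_le (hw.differentiable j hj) hC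
  rw [← uIcc_of_le (by linarith)] at this
  exact this.absolutelyContinuousOnInterval

/-- Inside the interval the one-sided derivative is the ordinary one; absolute continuity gives the
second derivative almost everywhere, and the indices are countable. -/
lemma hasDerivAt_ae (hw : Admissible T N w) : ∀ᵐ t, t ∈ Ioo (-T) T → ∀ j,
    HasDerivAt (extendZero N w j) (extendZero N (dt T w) j t) t ∧
      HasDerivAt (extendZero N (dt T w) j) (extendZero N (dt T (dt T w)) j t) t := by
  have h : ∀ᵐ t, ∀ j, j ∈ Finset.Icc 1 N → t ∈ uIcc (-T) T → DifferentiableAt ℝ (dt T w j) t := by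
    rw [ae_all_iff]
    intro j
    by_cases hj : j ∈ Finset.Icc 1 N
    · filter_upwards [(hw.absolutelyContinuous j hj).ae_differentiableAt] with t ht _ using ht
    · exact .of_forall fun t h => absurd h hj
  filter_upwards [h] with t ht htm j
  have hnhds : Icc (-T) T ∈ nhds t := Icc_mem_nhds htm.1 htm.2
  by_cases hj : j ∈ Finset.Icc 1 N
  · simp only [extendZero_of_mem hj]
    have h1 := (hw.differentiable j hj).differentiableAt hnhds
    have h2 := ht j hj (by rw [uIcc_of_le (by linarith [htm.1, htm.2])]
                           exact Ioo_subset_Icc_self htm)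
    constructor
    · rw [dt, derivWithin_of_mem_nhds hnhds]; exact h1.hasDerivAt
    · rw [dt, derivWithin_of_mem_nhds hnhds]; exact h2.hasDerivAt
  · simp only [extendZero_of_notMem hj]
    exact ⟨hasDerivAt_const t 0, hasDerivAt_const t 0⟩

/-- At the two boundary nodes `w` vanishes on an open interval, so its time derivative vanishes
there as well. Nothing is known at `t = ±T`. -/
lemma extendZero_eq (hw : Admissible T N w) {j : ℕ} (hj : j ≤ N + 1) {t : ℝ}
    (ht : t ∈ Ioo (-T) T) :
    extendZero N w j t = w j t ∧ extendZero N (dt T w) j t = dt T w j t := by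
  by_cases hjm : j ∈ Finset.Icc 1 N
  · simp only [extendZero_of_mem hjm, and_self]
  · simp only [extendZero_of_notMem hjm]
    have hz : ∀ r ∈ Ioo (-T) T, w j r = 0 := by
      intro r hr
      have hb := hw.boundary r hr
      rw [Finset.mem_Icc] at hjm
      obtain rfl | rfl : j = 0 ∨ j = N + 1 := by omega
      exacts [hb.1, hb.2]
    refine ⟨(hz t ht).symm, ?_⟩
    rw [dt, derivWithin_of_mem_nhds (Icc_mem_nhds ht.1 ht.2)]
    have : w j =ᶠ[nhds t] fun _ => 0 := by
      filter_upwards [Ioo_mem_nhds ht.1 ht.2] with r hr using hz r hr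
    rw [this.deriv_eq, deriv_const]

lemma waveOp_eq (hw : Admissible T N w) {j : ℕ} (hj : j ∈ Finset.Icc 1 N) {t : ℝ}
    (ht : t ∈ Ioo (-T) T) :
    waveOp T N w j t = extendZero N (dt T (dt T w)) j t - lap N (fun i => extendZero N w i t) j := by
  rw [extendZero_of_mem hj, waveOp, lap, lap]
  rw [Finset.mem_Icc] at hj
  rw [(hw.extendZero_eq (by omega) ht).1, (hw.extendZero_eq (by omega) ht).1,
    (hw.extendZero_eq (by omega) ht).1]

end Admissible

end Extension

end

end DiscreteWave

/-! ### The Carleman estimate -/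

theorem theorem2p2 (T β x0 C0 : ℝ) (hT : 0 < T) (hβ : 0 < β ∧ β < 1) (hx0 : x0 < 0)
    (hC0 : 0 < C0)
    (hψ : ∀ t ∈ Set.Icc (-T) T, ∀ x ∈ Set.Icc (0 : ℝ) 1, 1 ≤ DiscreteWave.psi x0 β C0 t x) :
    ∃ s0 lam ε h0 M : ℝ, 0 < s0 ∧ 0 < lam ∧ 0 < ε ∧ 0 < h0 ∧ 0 < M ∧
      ∀ N : ℕ, DiscreteWave.mesh N < h0 →
      ∀ s : ℝ, s0 < s → s < ε / DiscreteWave.mesh N →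
      ∀ w : ℕ → ℝ → ℝ, DiscreteWave.Admissible T N w →
        s * (∫ t in (-T)..T, DiscreteWave.intOpen N fun j =>
            Real.exp (2 * s * DiscreteWave.phi x0 β C0 lam t (DiscreteWave.node N j)) *
              |DiscreteWave.dt T w j t| ^ 2)
        + s * (∫ t in (-T)..T, DiscreteWave.intLeft N fun j =>
            Real.exp (2 * s * DiscreteWave.phi x0 β C0 lam t (DiscreteWave.node N j)) *
              |DiscreteWave.dPlus N (fun i => w i t) j| ^ 2)
        + s ^ 3 * (∫ t in (-T)..T, DiscreteWave.intOpen N fun j =>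
            Real.exp (2 * s * DiscreteWave.phi x0 β C0 lam t (DiscreteWave.node N j)) *
              |w j t| ^ 2)
        ≤ M * (∫ t in (-T)..T, DiscreteWave.intOpen N fun j =>
            Real.exp (2 * s * DiscreteWave.phi x0 β C0 lam t (DiscreteWave.node N j)) *
              |DiscreteWave.waveOp T N w j t| ^ 2)
        + M * s * (∫ t in (-T)..T,
            Real.exp (2 * s * DiscreteWave.phi x0 β C0 lam t 1) *
              |DiscreteWave.dMinus N (fun i => w i t) (N + 1)| ^ 2)
        + M * s * (∫ t in (-T)..T, DiscreteWave.intLeft N fun j =>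
            Real.exp (2 * s * DiscreteWave.phi x0 β C0 lam t (DiscreteWave.node N j)) *
              |DiscreteWave.mesh N *
                DiscreteWave.dPlus N (fun i => DiscreteWave.dt T w i t) j| ^ 2) := by
  have hden : 0 < (1 - β) * x0 ^ 2 := mul_pos (by linarith [hβ.2]) (sq_pos_iff.2 hx0.ne)
  obtain ⟨M, σ, δ, hM, hσ, hδ, hest⟩ := (DiscreteWave.expWeight T β x0 C0 hβ hx0 hψ
    (1 / ((1 - β) * x0 ^ 2)) (by positivity) (one_div_mul_cancel hden.ne')).exists_integrated_estimate hT
  -- `λ` is the value normalised by `λ (1 - β) x0² = 1`. One `δ` bounds both `h` and `sh`, so it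
  -- serves as `h0` and as `ε`.
  refine ⟨σ, 1 / ((1 - β) * x0 ^ 2), δ, δ, M, by linarith, by positivity, hδ, hδ, hM, ?_⟩
  intro N hN s hs hsδ w hw
  have hsh : s * DiscreteWave.mesh N ≤ δ :=
    ((lt_div_iff₀ (DiscreteWave.mesh_pos N)).1 hsδ).le
  have hmain := hest N hN.le s hs hsh (DiscreteWave.extendZero N w)
    (DiscreteWave.extendZero N (DiscreteWave.dt T w))
    (DiscreteWave.extendZero N (DiscreteWave.dt T (DiscreteWave.dt T w)))
    (DiscreteWave.absolutelyContinuous_extendZero fun j hj => hw.absolutelyContinuous_self hT hj)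
    (DiscreteWave.absolutelyContinuous_extendZero hw.absolutelyContinuous) hw.hasDerivAt_ae
    (fun j => by
      by_cases hj : j ∈ Finset.Icc 1 N
      · simpa only [DiscreteWave.extendZero_of_mem hj] using hw.final j hj
      · simp only [DiscreteWave.extendZero_of_notMem hj, and_self])
    (fun j => by
      by_cases hj : j ∈ Finset.Icc 1 N
      · simpa only [DiscreteWave.extendZero_of_mem hj] using hw.initial j hj
      · simp only [DiscreteWave.extendZero_of_notMem hj, and_self])
    (fun t => by simp [DiscreteWave.extendZero])
    (fun j hj => (MeasureTheory.memLp_congr_ae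
      ((MeasureTheory.ae_restrict_iff' measurableSet_Ioo).2
        (.of_forall fun t ht => hw.waveOp_eq hj ht))).1 (hw.memL2 j hj))
  -- Edge sums reach the nodes `0` and `N + 1`, where `w` agrees with its extension only for `t` in
  -- the open interval; this is enough under the integral.
  have hext : ∀ t ∈ Set.Ioo (-T) T, ∀ j ∈ Finset.range (N + 1),
      w j t = DiscreteWave.extendZero N w j t ∧
      w (j + 1) t = DiscreteWave.extendZero N w (j + 1) t ∧
      DiscreteWave.dt T w j t = DiscreteWave.extendZero N (DiscreteWave.dt T w) j t ∧
      DiscreteWave.dt T w (j + 1) t =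
        DiscreteWave.extendZero N (DiscreteWave.dt T w) (j + 1) t := by
    intro t ht j hj
    rw [Finset.mem_range] at hj
    have h1 := hw.extendZero_eq (j := j) (by omega) ht
    have h2 := hw.extendZero_eq (j := j + 1) (by omega) ht
    exact ⟨h1.1.symm, h2.1.symm, h1.2.symm, h2.2.symm⟩
  convert hmain using 3
  · congr 1
    refine DiscreteWave.integral_congr_of_Ioo hT fun t ht => ?_
    refine congrArg (DiscreteWave.mesh N * ·) (Finset.sum_congr rfl fun j hj => ?_)
    beta_reduce
    rw [DiscreteWave.extendZero_of_mem hj]; rfl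
  · congr 1
    refine DiscreteWave.integral_congr_of_Ioo hT fun t ht => ?_
    refine congrArg (DiscreteWave.mesh N * ·) (Finset.sum_congr rfl fun j hj => ?_)
    simp only [DiscreteWave.dPlus, (hext t ht j hj).1, (hext t ht j hj).2.1]; rfl
  · refine DiscreteWave.integral_congr_of_Ioo hT fun t ht => ?_
    refine congrArg (DiscreteWave.mesh N * ·) (Finset.sum_congr rfl fun j hj => ?_)
    beta_reduce
    rw [DiscreteWave.extendZero_of_mem hj]; rfl
  · congr 1
    refine DiscreteWave.integral_congr_of_Ioo hT fun t ht => ?_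
    refine congrArg (DiscreteWave.mesh N * ·) (Finset.sum_congr rfl fun j hj => ?_)
    beta_reduce
    rw [hw.waveOp_eq hj ht]; rfl
  · congr 1
    refine DiscreteWave.integral_congr_of_Ioo hT fun t ht => ?_
    have h := hext t ht N (Finset.self_mem_range_succ N)
    simp only [DiscreteWave.dMinus, Nat.add_sub_cancel, h.1, h.2.1]; rfl
  · refine DiscreteWave.integral_congr_of_Ioo hT fun t ht => ?_
    refine congrArg (DiscreteWave.mesh N * ·) (Finset.sum_congr rfl fun j hj => ?_)
    simp only [DiscreteWave.dPlus, (hext t ht j hj).2.2.1, (hext t ht j hj).2.2.2]; rfl
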